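/- **Setting.** Let $T,r,\mu,\sigma>0$ with $\mu\neq r$, let $W$ be a standard Brownian motion on $[0,T]$ on a complete probability space $(\Omega,\mathcal F,\mathbb P)$, and let $\mathcal F=\mathcal F_T$ be the $\sigma$-algebra generated by $(W_s)_{0\le s\le T}$ and all null sets. Put $\theta=(\mu-r)/\sigma$ and let $\xi_T=\exp\big(-(r+\tfrac{\theta^2}{2})T-\theta W_T\big)$ be the state price density at $T$ of the Black–Scholes market with interest rate $r$, appreciation rate $\mu$ and volatility $\sigma$. For a random variable $Y$ with values in $[-\infty,\infty]$ let $G_Y(z)=\inf\{y\in\mathbb R:\mathbb P(Y\le y)>z\}$ for $z\in[0,1)$ and $G_Y(1)=\lim_{z\uparrow1}G_Y(z)$; for a probability measure $\Phi$ on $[0,1]$ let $\rho_\Phi(Y)=-\int_{[0,1]}G_Y(z)\,\Phi(dz)$, and let $\mathrm{VaR}_\alpha(Y)=-G_Y(\alpha)$. Write $G_\xi=G_{\xi_T}$ and $$w(s)=\frac{1}{\mathbb E[\xi_T]}\int_{[0,s)}G_\xi(1-z)\,dz,\qquad s\in[0,1],$$ with inverse $w^{-1}:[0,1]\to[0,1]$,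 and $$\varphi(s-;\lambda)=\frac{\Phi([0,w^{-1}(s)))+\lambda w^{-1}(s)}{1+\lambda},\qquad s\in[0,1].$$ Fix an initial endowment $x>0$. An admissible terminal wealth is an $\mathcal F_T$-measurable $X_T\ge0$ a.s. with $\mathbb E[\xi_TX_T]\le x$; its log-return is $R_T=\frac1T\ln\frac{X_T}{x}$, with $\ln0=-\infty$. The min-VaR terminal wealth ($\lambda=0$) is the minimizer of $\rho_\Phi(R_T)$, and for $0<\lambda<\infty$ the mean-VaR efficient terminal wealth is the maximizer of $\lambda\mathbb E[R_T]-\rho_\Phi(R_T)$, over all admissible terminal wealths, where $\Phi$ is the Dirac measure at $\alpha\in(0,1)$. Put $\xi_\alpha=G_\xi(1-\alpha)$. **Proposition 4.1.** Let $\Phi$ be the Dirac measure at $\alpha\in(0,1)$. *Case $\lambda=0$.* Let $\underline X_{\mathrm{VaR}}=\dfrac{x}{\mathbb E[\xi_T]}\cdot\dfrac1{1-w(\alpha)}$. The a.s. unique min-VaR terminal wealth is $$X^{\mathrm{VaR}}_{T,0}=\begin{cases}0,&\xi_T>\xi_\alpha,\\ \underline X_{\mathrm{VaR}},&\xi_T\le\xi_\alpha.\end{cases}$$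 Its log-return is $R^{\mathrm{VaR}}_{T,0}=\frac1T\ln\frac{X^{\mathrm{VaR}}_{T,0}}{x}$ (that is, $-\infty$ if $\xi_T>\xi_\alpha$ and $\frac1T\ln\frac{\underline X_{\mathrm{VaR}}}{x}$ otherwise), $\mathbb E[R^{\mathrm{VaR}}_{T,0}]=-\infty$, and $$\mathrm{VaR}_\alpha(R^{\mathrm{VaR}}_{T,0})=-\frac1T\ln\frac{\underline X_{\mathrm{VaR}}}{x}.$$ *Case $0<\lambda<\infty$.* There is a unique $s^*(\lambda)\in(w(\alpha),1)$ at which $\varphi(\cdot-;\lambda)$ is differentiable with derivative $$\frac{\varphi(s^*(\lambda)-;\lambda)-\varphi(w(\alpha)-;\lambda)}{s^*(\lambda)-w(\alpha)}.$$ With $\underline\xi_{\mathrm{VaR}}=G_\xi\big(1-w^{-1}(s^*(\lambda))\big)$ and $\underline X_{\mathrm{VaR}}=\dfrac{\lambda}{1+\lambda}\cdot\dfrac{x}{\underline\xi_{\mathrm{VaR}}}$, the a.s. unique mean-VaR efficient terminal wealth is $$X^{\mathrm{VaR}}_{T,\lambda}=\begin{cases}\frac{\lambda}{1+\lambda}\cdot\frac{x}{\xi_T},&\xi_T>\xi_\alpha,\\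 \underline X_{\mathrm{VaR}},&\underline\xi_{\mathrm{VaR}}<\xi_T\le\xi_\alpha,\\ \frac{\lambda}{1+\lambda}\cdot\frac{x}{\xi_T},&\xi_T\le\underline\xi_{\mathrm{VaR}}.\end{cases}$$ Its log-return is the finite random variable $R^{\mathrm{VaR}}_{T,\lambda}=\frac1T\ln\frac{X^{\mathrm{VaR}}_{T,\lambda}}{x}$, and $$\mathrm{VaR}_\alpha(R^{\mathrm{VaR}}_{T,\lambda})=-\frac1T\ln\frac{\underline X_{\mathrm{VaR}}}{x}.$$ -/

import Mathlib

open MeasureTheory ProbabilityTheory Set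

namespace MeanWVaR

noncomputable section

/-! ### Extended-real integrals, quantile functions and risk measures -/

/-- Integral of an extended-real function: integral of the positive part minus integral of the
negative part. If both are infinite the value is `⊤ - ⊤ = ⊥`, and if `f = ⊥` on a set of positive
measure it is `⊥`: an integral of log-returns is `-∞` as soon as the measure charges the states
with log-return `-∞`. -/
def eIntegral {α : Type*} [MeasurableSpace α] (ν : Measure α) (f : α → EReal) : EReal :=
  ((∫⁻ a, (f a).toENNReal ∂ν : ENNReal) : EReal) - ((∫⁻ a, (-f a).toENNReal ∂ν : ENNReal) : EReal)

variable {Ω : Type*} [MeasurableSpace Ω]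

/-- Upper quantile function for a level `z < 1`: `inf {y ∈ ℝ : F_R(y) > z}`, where
`F_R(y) = P(R ≤ y)`. The variable `R` may take the value `-∞`, and then so may the quantile. -/
def upperQuantile (P : Measure Ω) (R : Ω → EReal) (z : ℝ) : EReal :=
  sInf ((fun y : ℝ => (y : EReal)) '' {y : ℝ | z < P.real {ω | R ω ≤ (y : EReal)}})

/-- Quantile function `G_R` on `[0,1]`: the upper quantile on `[0,1)`, and at `1` its left limit,
which is the supremum because the upper quantile is nondecreasing. -/
def quantile (P : Measure Ω) (R : Ω → EReal) (z : ℝ) : EReal :=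
  if z < 1 then upperQuantile P R z else ⨆ u : Iio (1 : ℝ), upperQuantile P R u

/-- Expectation of an extended-real random variable. -/
def expect (P : Measure Ω) (R : Ω → EReal) : EReal := eIntegral P R

/-- Weighted Value-at-Risk `ρ_Φ(R) = -∫_{[0,1]} G_R(z) Φ(dz)`. -/
def wvar (P : Measure Ω) (Φ : Measure ℝ) (R : Ω → EReal) : EReal :=
  -eIntegral (Φ.restrict (Icc 0 1)) (quantile P R)

/-- Value-at-Risk `VaR_α(R) = -G_R(α)`. -/
def valueAtRisk (P : Measure Ω) (α : ℝ) (R : Ω → EReal) : EReal := -quantile P R α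

/-- Log-return `(1/T) ln (X/x)`, with `ln 0 = -∞`. -/
def logReturn (T x : ℝ) (X : Ω → ℝ) (ω : Ω) : EReal :=
  ((1 / T : ℝ) : EReal) * ENNReal.log (ENNReal.ofReal (X ω / x))

/-! ### The Black-Scholes market -/

/-- `W` is a standard one-dimensional Brownian motion on the time interval `[0,T]`. -/
structure IsBrownianMotionOn (P : Measure Ω) (T : ℝ) (W : Icc (0 : ℝ) T → Ω → ℝ) : Prop where
  measurable : ∀ t, Measurable (W t)
  start : ∀ t : Icc (0 : ℝ) T, (t : ℝ) = 0 → ∀ᵐ ω ∂P, W t ω = 0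
  indep : HasIndepIncrements W P
  gaussian : ∀ s t : Icc (0 : ℝ) T, s ≤ t →
    P.map (fun ω => W t ω - W s ω) = gaussianReal 0 (Real.toNNReal ((t : ℝ) - s))
  continuous : ∀ᵐ ω ∂P, Continuous fun t => W t ω

/-- `σ(W_s, 0 ≤ s ≤ t)` augmented by all `P`-null sets. -/
@[reducible] def augmentedSigma (P : Measure Ω) {T : ℝ} (W : Icc (0 : ℝ) T → Ω → ℝ) (t : Icc (0 : ℝ) T) :
    MeasurableSpace Ω :=
  (⨆ s ∈ Iic t, MeasurableSpace.comap (W s) inferInstance) ⊔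
    MeasurableSpace.generateFrom {A : Set Ω | P A = 0}

/-- A Black-Scholes market on `[0,T]`: interest rate `r > 0`, a stock with appreciation rate
`μ > 0` and volatility `σ > 0`, driven by a Brownian motion `W`. The `σ`-algebra of the probability
space is the augmented Brownian one at time `T` (so the space is complete). -/
structure Market (P : Measure Ω) where
  T : ℝ
  r : ℝ
  μ : ℝ
  σ : ℝ
  T_pos : 0 < T
  r_pos : 0 < r
  μ_pos : 0 < μ
  σ_pos : 0 < σ
  W : Icc (0 : ℝ) T → Ω → ℝ
  brownian : IsBrownianMotionOn P T W
  sigma_eq : (inferInstance : MeasurableSpace Ω) = augmentedSigma P W ⟨T, T_pos.le, le_rfl⟩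

namespace Market

variable {P : Measure Ω} (M : Market P)

/-- Market price of risk. -/
def θ : ℝ := (M.μ - M.r) / M.σ

/-- State price density process: the solution
`ξ_t = exp (-(r + θ²/2) t - θ W_t)` of `dξ = -r ξ dt - θ ξ dW`, `ξ_0 = 1`. -/
def ξ (t : Icc (0 : ℝ) M.T) (ω : Ω) : ℝ :=
  Real.exp (-(M.r + M.θ ^ 2 / 2) * t - M.θ * M.W t ω)

/-- State price density at the horizon. -/
def ξT (ω : Ω) : ℝ := M.ξ ⟨M.T, M.T_pos.le, le_rfl⟩ ω

/-- `E[ξ_T]`. -/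
def meanξ : ℝ := ∫ ω, M.ξT ω ∂P

/-- Quantile function `G_ξ` of `ξ_T`; it is finite on `[0,1)`, where it is used. -/
def Gξ (z : ℝ) : ℝ := (quantile P (fun ω => (M.ξT ω : EReal)) z).toReal

/-- `w(s) = (1 / E[ξ_T]) ∫_{[0,s)} G_ξ(1-z) dz`. -/
def w (s : ℝ) : ℝ := (∫ z in Ico 0 s, M.Gξ (1 - z)) / M.meanξ

/-- Inverse function of `w : [0,1] → [0,1]`. -/
def wInv (s : ℝ) : ℝ := Function.invFunOn M.w (Icc 0 1) s

/-- `φ(s-; λ) = (Φ([0, w⁻¹(s))) + λ w⁻¹(s)) / (1 + λ)`. -/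
def φLeft (Φ : Measure ℝ) (lam : ℝ) (s : ℝ) : ℝ :=
  (Φ.real (Ico 0 (M.wInv s)) + lam * M.wInv s) / (1 + lam)

/-- `s ∈ (w(α), 1)`, and the tangent to `φ(·-; λ)` at `s` is the chord from the point of its graph
at `w(α)`. -/
def IsTangency (Φ : Measure ℝ) (α lam s : ℝ) : Prop :=
  s ∈ Ioo (M.w α) 1 ∧
    HasDerivAt (M.φLeft Φ lam)
      ((M.φLeft Φ lam s - M.φLeft Φ lam (M.w α)) / (s - M.w α)) s

/-! ### The portfolio choice problems -/

/-- Admissible terminal wealth with initial endowment `x`: an `F_T`-measurable random variable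
`X ≥ 0` with `E[ξ_T X] ≤ x`. -/
structure Feasible (x : ℝ) (X : Ω → ℝ) : Prop where
  measurable : Measurable X
  nonneg : ∀ᵐ ω ∂P, 0 ≤ X ω
  budget : ∫⁻ ω, ENNReal.ofReal (M.ξT ω * X ω) ∂P ≤ ENNReal.ofReal x

/-- The log-return over `[0,T]` of a terminal wealth. -/
def R (x : ℝ) (X : Ω → ℝ) : Ω → EReal := logReturn M.T x X

/-- The objective `λ E[R_T] - ρ_Φ(R_T)`. -/
def objective (Φ : Measure ℝ) (lam x : ℝ) (X : Ω → ℝ) : EReal :=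
  (lam : EReal) * expect P (M.R x X) - wvar P Φ (M.R x X)

/-- `X` maximizes `λ E[R_T] - ρ_Φ(R_T)` over the admissible terminal wealths. -/
def IsEfficient (Φ : Measure ℝ) (lam x : ℝ) (X : Ω → ℝ) : Prop :=
  M.Feasible x X ∧ ∀ Y, M.Feasible x Y → M.objective Φ lam x Y ≤ M.objective Φ lam x X

/-- `X` minimizes `ρ_Φ(R_T)` over the admissible terminal wealths (the case `λ = 0`). -/
def IsMinRisk (Φ : Measure ℝ) (x : ℝ) (X : Ω → ℝ) : Prop :=
  M.Feasible x X ∧ ∀ Y, M.Feasible x Y → wvar P Φ (M.R x X) ≤ wvar P Φ (M.R x Y)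

/-! ### The candidate optimal wealths -/

/-- `ξ_α = G_ξ(1 - α)`. -/
def ξα (α : ℝ) : ℝ := M.Gξ (1 - α)

/-- The payoff level `x / (E[ξ_T] (1 - w(α)))`. -/
def minVaRLevel (α x : ℝ) : ℝ := x / M.meanξ * (1 / (1 - M.w α))

/-- The digital payoff: `0` if `ξ_T > ξ_α`, and the constant level otherwise. -/
def minVaRWealth (α x : ℝ) (ω : Ω) : ℝ :=
  if M.ξα α < M.ξT ω then 0 else M.minVaRLevel α x

/-- The lower threshold `G_ξ(1 - w⁻¹(s))` for the state price density. -/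
def ξLow (s : ℝ) : ℝ := M.Gξ (1 - M.wInv s)

/-- The payoff level `(λ / (1 + λ)) x / G_ξ(1 - w⁻¹(s))`. -/
def effVaRLevel (lam x s : ℝ) : ℝ := lam / (1 + lam) * (x / M.ξLow s)

/-- `(λ / (1 + λ)) x / ξ_T`, except for the constant level where `ξLow s < ξ_T ≤ ξ_α`. -/
def effVaRWealth (α lam x s : ℝ) (ω : Ω) : ℝ :=
  if M.ξα α < M.ξT ω then lam / (1 + lam) * (x / M.ξT ω)
  else if M.ξLow s < M.ξT ω then M.effVaRLevel lam x s
  else lam / (1 + lam) * (x / M.ξT ω)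

end Market

end

end MeanWVaR

/-! The state price density `ξ = ξ_T` is lognormal with positive variance, because `μ ≠ r`. Hence
its distribution function is continuous and strictly increasing on `[0, ∞)`, `G_ξ` is its inverse
on `(0, 1)`, and the quantile transform (`map_Gξ`) turns the primitive `w` of `G_ξ(1 - ·)` into a
tail expectation: `E[ξ] w(P(ξ > y)) = E[ξ; ξ > y]` (`w_one_sub_Fξ`). A wealth `X` has a log-return
whose `α`-quantile is at least that of the constant `c` iff `P(X < c) ≤ α`
(`coe_le_quantile_iff`). Write `β = ξ_α`, so that `P(ξ ≤ β) = 1 - α`.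

For `λ = 0` the question is how large `c` can be if `X ≥ c` on an event of probability `1 - α` and
`X` costs at most `x`. By a Neyman-Pearson argument the event `ξ ≤ β` is the cheapest
(`digital_cost_le`), and the digital payoff is the only wealth that attains the bound.

For `0 < λ < ∞` the problem is to maximise `E[log X] + (1/λ) log c` over the wealths `X` and floors
`c` with `P(X ≥ c) ≥ 1 - α`. The tangency condition says that the lower threshold `l = ξLow s`
solves `λ E[(ξ - l)⁺; ξ ≤ β] = l` (`isTangency_iff`). This equation has exactly one solution
(`existsUnique_truncCall_eq`), makes the candidate exhaust the budget, and normalises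
`λ (ξ/l - 1)` on `l < ξ ≤ β` to a probability density. With `b = λ x / (1 + λ)`, add to
`log X - ξ X / b` a multiplier times `1_{X ≥ c} - 1_{ξ ≤ β}` and this density (over `λ`) times
`log c`. If the multiplier is the utility cost of the floor `c` at `ξ = β`, the resulting Lagrangian
is maximised state by state by the candidate with its floor `b / l` (`lagrangian_le`); integrating
gives optimality, and the equality case, uniqueness (`expected_log_add_le`). The problem is not
concave in `X` because of the probability constraint, so the multiplier depends on the competing
floor `c`, and equality of the floors is deduced from the states `l < ξ ≤ β`. -/

namespace MeanWVaR

namespace Market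

variable {Ω : Type*} [MeasurableSpace Ω] {P : Measure Ω} (M : Market P)

/-! ### The law of the state price density -/

lemma ξT_pos (ω : Ω) : 0 < M.ξT ω := Real.exp_pos _

lemma measurable_ξT : Measurable M.ξT :=
  Real.measurable_exp.comp
    (measurable_const.sub ((M.brownian.measurable ⟨M.T, M.T_pos.le, le_rfl⟩).const_mul _))

lemma θ_ne_zero (hθ : M.μ ≠ M.r) : M.θ ≠ 0 :=
  div_ne_zero (sub_ne_zero.2 hθ) M.σ_pos.ne'

lemma map_W_horizon :
    P.map (M.W ⟨M.T, M.T_pos.le, le_rfl⟩) = gaussianReal 0 (Real.toNNReal M.T) := by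
  have h := M.brownian.gaussian ⟨0, le_rfl, M.T_pos.le⟩ ⟨M.T, M.T_pos.le, le_rfl⟩ M.T_pos.le
  simp only [sub_zero] at h
  rw [← h]
  refine Measure.map_congr ?_
  filter_upwards [M.brownian.start ⟨0, le_rfl, M.T_pos.le⟩ rfl] with ω hω
  simp [hω]

lemma toNNReal_T_ne_zero : Real.toNNReal M.T ≠ 0 := by
  simpa using M.T_pos

lemma integrable_ξT : Integrable M.ξT P := by
  have h : Integrable (fun y : ℝ => Real.exp (-M.θ * y)) (gaussianReal 0 (Real.toNNReal M.T)) :=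
    integrable_exp_mul_gaussianReal _
  rw [← M.map_W_horizon] at h
  have h2 := (h.comp_measurable (M.brownian.measurable _)).const_mul
    (Real.exp (-(M.r + M.θ ^ 2 / 2) * M.T))
  refine h2.congr (Filter.Eventually.of_forall fun ω => ?_)
  simp only [ξT, ξ, Function.comp_apply, ← Real.exp_add]
  ring_nf

lemma integrable_log_ξT [IsProbabilityMeasure P] :
    Integrable (fun ω => Real.log (M.ξT ω)) P := by
  have h : Integrable (fun y : ℝ => y) (gaussianReal 0 (Real.toNNReal M.T)) :=
    (memLp_id_gaussianReal 1).integrable (by norm_num)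
  rw [← M.map_W_horizon] at h
  have h2 := (integrable_const (-(M.r + M.θ ^ 2 / 2) * M.T)).sub
    ((h.comp_measurable (M.brownian.measurable _)).const_mul M.θ)
  refine h2.congr (Filter.Eventually.of_forall fun ω => ?_)
  simp [ξT, ξ]

/-- The law of `ξ_T` has no atoms. -/
lemma measure_ξT_eq (hθ : M.μ ≠ M.r) (y : ℝ) : P {ω | M.ξT ω = y} = 0 := by
  have h0 : P (M.W ⟨M.T, M.T_pos.le, le_rfl⟩ ⁻¹'
      {(-(M.r + M.θ ^ 2 / 2) * M.T - Real.log y) / M.θ}) = 0 := by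
    rw [← Measure.map_apply (M.brownian.measurable _) (measurableSet_singleton _),
      M.map_W_horizon]
    exact gaussianReal_absolutelyContinuous _ M.toNNReal_T_ne_zero (by simp)
  refine measure_mono_null (fun ω (hω : M.ξT ω = y) => ?_) h0
  simp only [mem_preimage, mem_singleton_iff]
  rw [← hω, eq_div_iff (M.θ_ne_zero hθ)]
  simp only [ξT, ξ, Real.log_exp]
  ring

/-- The law of `ξ_T` charges every interval of positive numbers. -/
lemma measure_ξT_mem_Ioo_pos (hθ : M.μ ≠ M.r) {a b : ℝ} (ha : 0 ≤ a) (hab : a < b) :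
    0 < P {ω | M.ξT ω ∈ Ioo a b} := by
  have hθ' := M.θ_ne_zero hθ
  set f : ℝ → ℝ := fun y => Real.exp (-(M.r + M.θ ^ 2 / 2) * M.T - M.θ * y) with hf
  have hfc : Continuous f := by fun_prop
  have hset : {ω | M.ξT ω ∈ Ioo a b} =
      M.W ⟨M.T, M.T_pos.le, le_rfl⟩ ⁻¹' (f ⁻¹' Ioo a b) := rfl
  rw [hset, ← Measure.map_apply (M.brownian.measurable _) (hfc.measurable measurableSet_Ioo),
    M.map_W_horizon, pos_iff_ne_zero]
  intro h0
  have h1 := gaussianReal_absolutelyContinuous' 0 M.toNNReal_T_ne_zero h0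
  refine ((isOpen_Ioo.preimage hfc).measure_pos volume
    ⟨(-(M.r + M.θ ^ 2 / 2) * M.T - Real.log ((a + b) / 2)) / M.θ, ?_⟩).ne' h1
  have : f ((-(M.r + M.θ ^ 2 / 2) * M.T - Real.log ((a + b) / 2)) / M.θ) = (a + b) / 2 := by
    simp only [hf]
    rw [mul_div_cancel₀ _ hθ', sub_sub_cancel, Real.exp_log (by linarith)]
  rw [mem_preimage, this]
  constructor <;> linarith

lemma meanξ_pos [IsProbabilityMeasure P] : 0 < M.meanξ := by
  rw [meanξ, integral_pos_iff_support_of_nonneg (fun ω => (M.ξT_pos ω).le) M.integrable_ξT]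
  have : Function.support M.ξT = univ := by
    ext ω; simp [(M.ξT_pos ω).ne']
  simp [this]

/-- Distribution function of `ξ_T`. -/
noncomputable def Fξ (y : ℝ) : ℝ := P.real {ω | M.ξT ω ≤ y}

lemma Fξ_nonpos {y : ℝ} (hy : y ≤ 0) : M.Fξ y = 0 := by
  have : {ω | M.ξT ω ≤ y} = ∅ := by
    ext ω; simpa using hy.trans_lt (M.ξT_pos ω)
  simp [Fξ, this]

variable [IsProbabilityMeasure P]

lemma Fξ_mono : Monotone M.Fξ := fun _ _ h =>
  measureReal_mono (fun _ hω => le_trans hω h)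

lemma Fξ_eq_cdf : M.Fξ = cdf (P.map M.ξT) := by
  have := Measure.isProbabilityMeasure_map (μ := P) M.measurable_ξT.aemeasurable
  ext y
  rw [cdf_eq_real, map_measureReal_apply M.measurable_ξT measurableSet_Iic]
  rfl

lemma Fξ_continuous (hθ : M.μ ≠ M.r) : Continuous M.Fξ := by
  have := Measure.isProbabilityMeasure_map (μ := P) M.measurable_ξT.aemeasurable
  rw [M.Fξ_eq_cdf, continuous_iff_continuousAt]
  intro y
  have h1 : (cdf (P.map M.ξT)).measure {y} = 0 := by
    rw [measure_cdf, Measure.map_apply M.measurable_ξT (measurableSet_singleton _)]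
    exact M.measure_ξT_eq hθ y
  rw [StieltjesFunction.measure_singleton, ENNReal.ofReal_eq_zero] at h1
  have h2 := (monotone_cdf (P.map M.ξT)).leftLim_le (le_refl y)
  rw [(monotone_cdf (P.map M.ξT)).continuousAt_iff_leftLim_eq_rightLim]
  rw [StieltjesFunction.rightLim_eq]
  linarith

lemma Fξ_lt {a b : ℝ} (hθ : M.μ ≠ M.r) (ha : 0 ≤ a) (hab : a < b) : M.Fξ a < M.Fξ b := by
  have h := M.measure_ξT_mem_Ioo_pos hθ ha hab
  have hd : Disjoint {ω | M.ξT ω ≤ a} {ω | M.ξT ω ∈ Ioo a b} := by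
    rw [Set.disjoint_left]
    intro ω h1 h2
    exact absurd h2.1 (not_lt.2 h1)
  have h3 : P.real ({ω | M.ξT ω ≤ a} ∪ {ω | M.ξT ω ∈ Ioo a b}) ≤ M.Fξ b :=
    measureReal_mono (by
      rintro ω (h1 | h1)
      · exact le_trans h1 hab.le
      · exact h1.2.le)
  rw [measureReal_union hd (M.measurable_ξT measurableSet_Ioo)] at h3
  have h4 : 0 < P.real {ω | M.ξT ω ∈ Ioo a b} :=
    ENNReal.toReal_pos h.ne' (measure_ne_top _ _)
  have h5 : M.Fξ a = P.real {ω | M.ξT ω ≤ a} := rfl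
  linarith

lemma Fξ_pos (hθ : M.μ ≠ M.r) {y : ℝ} (hy : 0 < y) : 0 < M.Fξ y := by
  have := M.Fξ_lt hθ le_rfl hy
  rwa [M.Fξ_nonpos le_rfl] at this

lemma Fξ_lt_one (hθ : M.μ ≠ M.r) {y : ℝ} (hy : 0 < y) : M.Fξ y < 1 :=
  (M.Fξ_lt hθ hy.le (lt_add_one y)).trans_le measureReal_le_one

lemma exists_Fξ_eq (hθ : M.μ ≠ M.r) {z : ℝ} (hz : z ∈ Ioo (0 : ℝ) 1) :
    ∃ y, 0 < y ∧ M.Fξ y = z := by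
  have h1 : Filter.Tendsto M.Fξ Filter.atTop (nhds 1) := by
    rw [M.Fξ_eq_cdf]; exact tendsto_cdf_atTop _
  obtain ⟨b, hb⟩ := (h1.eventually (lt_mem_nhds hz.2)).exists
  obtain ⟨y, hy⟩ := mem_range_of_exists_le_of_exists_ge (M.Fξ_continuous hθ)
    ⟨0, (M.Fξ_nonpos le_rfl).trans_le hz.1.le⟩ ⟨b, hb.le⟩
  refine ⟨y, ?_, hy⟩
  by_contra h
  rw [M.Fξ_nonpos (not_lt.1 h)] at hy
  exact hz.1.ne hy

/-- The quantile function inverts the distribution function on the positive numbers. -/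
lemma Gξ_Fξ (hθ : M.μ ≠ M.r) {y : ℝ} (hy : 0 < y) : M.Gξ (M.Fξ y) = y := by
  have hset : {y' : ℝ | M.Fξ y < P.real {ω | (M.ξT ω : EReal) ≤ (y' : EReal)}} = Ioi y := by
    ext y'
    simp only [EReal.coe_le_coe_iff, mem_ofPred_eq, mem_Ioi]
    change M.Fξ y < M.Fξ y' ↔ _
    exact ⟨fun h => M.Fξ_mono.reflect_lt h, fun h => M.Fξ_lt hθ hy.le h⟩
  have hinf : sInf ((fun y' : ℝ => (y' : EReal)) '' Ioi y) = (y : EReal) := by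
    refine le_antisymm ?_ (le_sInf ?_)
    · refine EReal.le_of_forall_lt_iff_le.1 fun z hz => sInf_le ⟨z, ?_, rfl⟩
      exact EReal.coe_lt_coe_iff.1 hz
    · rintro _ ⟨z, hz, rfl⟩
      exact EReal.coe_le_coe_iff.2 (le_of_lt hz)
  rw [Gξ, quantile, if_pos (M.Fξ_lt_one hθ hy), upperQuantile, hset, hinf, EReal.toReal_coe]

lemma Gξ_pos (hθ : M.μ ≠ M.r) {z : ℝ} (hz : z ∈ Ioo (0 : ℝ) 1) : 0 < M.Gξ z := by
  obtain ⟨y, hy, rfl⟩ := M.exists_Fξ_eq hθ hz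
  rwa [M.Gξ_Fξ hθ hy]

lemma Fξ_Gξ (hθ : M.μ ≠ M.r) {z : ℝ} (hz : z ∈ Ioo (0 : ℝ) 1) : M.Fξ (M.Gξ z) = z := by
  obtain ⟨y, hy, rfl⟩ := M.exists_Fξ_eq hθ hz
  rw [M.Gξ_Fξ hθ hy]

lemma Gξ_le_iff (hθ : M.μ ≠ M.r) {z : ℝ} (hz : z ∈ Ioo (0 : ℝ) 1) (y : ℝ) :
    M.Gξ z ≤ y ↔ z ≤ M.Fξ y := by
  constructor
  · intro h
    exact (M.Fξ_Gξ hθ hz).symm.trans_le (M.Fξ_mono h)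
  · intro h
    by_contra! hlt
    have h1 : M.Fξ (max y 0) < z := by
      have := M.Fξ_lt hθ (le_max_right y 0) (max_lt hlt (M.Gξ_pos hθ hz))
      rwa [M.Fξ_Gξ hθ hz] at this
    exact absurd (h.trans (M.Fξ_mono (le_max_left y 0))) (not_le.2 h1)

lemma Gξ_strictMonoOn (hθ : M.μ ≠ M.r) : StrictMonoOn M.Gξ (Ioo 0 1) := by
  intro z hz z' hz' h
  by_contra! hle
  rw [M.Gξ_le_iff hθ hz', M.Fξ_Gξ hθ hz] at hle
  exact absurd h (not_lt.2 hle)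

lemma Gξ_continuousAt (hθ : M.μ ≠ M.r) {z : ℝ} (hz : z ∈ Ioo (0 : ℝ) 1) :
    ContinuousAt M.Gξ z := by
  refine (M.Gξ_strictMonoOn hθ).continuousAt_of_image_mem_nhds (Ioo_mem_nhds hz.1 hz.2) ?_
  refine Filter.mem_of_superset (Ioi_mem_nhds (M.Gξ_pos hθ hz)) fun y hy => ?_
  exact ⟨M.Fξ y, ⟨M.Fξ_pos hθ hy, M.Fξ_lt_one hθ hy⟩, M.Gξ_Fξ hθ hy⟩

lemma aemeasurable_Gξ (hθ : M.μ ≠ M.r) : AEMeasurable M.Gξ (volume.restrict (Ioo 0 1)) :=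
  aemeasurable_restrict_of_monotoneOn measurableSet_Ioo (M.Gξ_strictMonoOn hθ).monotoneOn

/-- The quantile transform: `G_ξ` of a uniform variable has the law of `ξ_T`. -/
lemma map_Gξ (hθ : M.μ ≠ M.r) : (volume.restrict (Ioo 0 1)).map M.Gξ = P.map M.ξT := by
  have hp := Measure.isProbabilityMeasure_map (μ := P) M.measurable_ξT.aemeasurable
  have : IsFiniteMeasure (volume.restrict (Ioo (0 : ℝ) 1)) := ⟨by simp⟩
  refine Measure.ext_of_Iic _ _ fun y => ?_
  rw [Measure.map_apply_of_aemeasurable (M.aemeasurable_Gξ hθ) measurableSet_Iic,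
    Measure.map_apply M.measurable_ξT measurableSet_Iic,
    Measure.restrict_apply' measurableSet_Ioo]
  have h1 : M.Gξ ⁻¹' Iic y ∩ Ioo 0 1 = Iic (M.Fξ y) ∩ Ioo 0 1 := by
    ext z
    simp only [mem_inter_iff, mem_preimage, mem_Iic, and_congr_left_iff]
    exact fun hz => M.Gξ_le_iff hθ hz y
  have hF1 : M.Fξ y ≤ 1 := measureReal_le_one
  have h2 : volume (Iic (M.Fξ y) ∩ Ioo 0 1) = ENNReal.ofReal (M.Fξ y) := by
    refine le_antisymm ?_ ?_
    · have hsub : Iic (M.Fξ y) ∩ Ioo 0 1 ⊆ Ioc 0 (M.Fξ y) := fun z hz => ⟨hz.2.1, hz.1⟩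
      exact (measure_mono hsub).trans (by simp)
    · have hsub : Ioo 0 (M.Fξ y) ⊆ Iic (M.Fξ y) ∩ Ioo 0 1 :=
        fun z hz => ⟨hz.2.le, hz.1, hz.2.trans_le hF1⟩
      exact le_trans (by simp) (measure_mono (μ := volume) hsub)
  rw [h1, h2, Fξ, ofReal_measureReal]
  rfl

lemma integrableOn_Gξ (hθ : M.μ ≠ M.r) : IntegrableOn M.Gξ (Ioo 0 1) := by
  have h : Integrable (fun y : ℝ => y) (P.map M.ξT) :=
    (integrable_map_measure (by fun_prop) M.measurable_ξT.aemeasurable).2 M.integrable_ξT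
  rw [← M.map_Gξ hθ] at h
  exact (integrable_map_measure (by fun_prop) (M.aemeasurable_Gξ hθ)).1 h

end Market

end MeanWVaR

namespace MeanWVaR

namespace Market

variable {Ω : Type*} [MeasurableSpace Ω] {P : Measure Ω} (M : Market P)

/-! ### The distortion `w` and its inverse -/

variable [IsProbabilityMeasure P]

lemma intervalIntegrable_Gξ (hθ : M.μ ≠ M.r) : IntervalIntegrable M.Gξ volume 0 1 := by
  rw [intervalIntegrable_iff_integrableOn_Ioo_of_le zero_le_one]
  exact M.integrableOn_Gξ hθ

lemma intervalIntegrable_Gξ_one_sub (hθ : M.μ ≠ M.r) :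
    IntervalIntegrable (fun z => M.Gξ (1 - z)) volume 0 1 := by
  simpa using ((M.intervalIntegrable_Gξ hθ).comp_sub_left 1).symm

omit [IsProbabilityMeasure P] in
lemma w_eq_intervalIntegral {s : ℝ} (hs : 0 ≤ s) :
    M.w s = (∫ z in 0..s, M.Gξ (1 - z)) / M.meanξ := by
  rw [w, intervalIntegral.integral_of_le hs, integral_Ico_eq_integral_Ioo,
    integral_Ioc_eq_integral_Ioo]

/-- By the quantile transform, the primitive of the quantile function of `ξ_T` is a tail
expectation of `ξ_T`. -/
lemma w_one_sub_Fξ (hθ : M.μ ≠ M.r) (y : ℝ) :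
    M.w (1 - M.Fξ y) * M.meanξ = ∫ ω in {ω | y < M.ξT ω}, M.ξT ω ∂P := by
  have hF1 : M.Fξ y ≤ 1 := measureReal_le_one
  have hF0 : 0 ≤ M.Fξ y := measureReal_nonneg
  rw [M.w_eq_intervalIntegral (sub_nonneg.2 hF1), div_mul_cancel₀ _ M.meanξ_pos.ne',
    intervalIntegral.integral_comp_sub_left, sub_sub_cancel, sub_zero,
    intervalIntegral.integral_of_le hF1, integral_Ioc_eq_integral_Ioo]
  have h1 : ∫ ω in {ω | y < M.ξT ω}, M.ξT ω ∂P = ∫ u in Ioi y, u ∂(P.map M.ξT) := by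
    rw [setIntegral_map measurableSet_Ioi (by fun_prop) M.measurable_ξT.aemeasurable]
    rfl
  rw [h1, ← M.map_Gξ hθ, ← integral_indicator measurableSet_Ioi,
    integral_map (M.aemeasurable_Gξ hθ)
      ((measurable_id'.indicator measurableSet_Ioi).aestronglyMeasurable),
    ← integral_indicator measurableSet_Ioo, ← integral_indicator measurableSet_Ioo]
  congr 1
  ext u
  by_cases hu : u ∈ Ioo (0 : ℝ) 1
  · have h2 : u ∈ Ioo (M.Fξ y) 1 ↔ M.Gξ u ∈ Ioi y := by
      have := M.Gξ_le_iff hθ hu y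
      simp only [mem_Ioo, hu.2, and_true, mem_Ioi]
      rw [← not_le, ← not_le, this]
    rw [indicator_of_mem hu]
    by_cases h3 : u ∈ Ioo (M.Fξ y) 1
    · rw [indicator_of_mem h3, indicator_of_mem (h2.1 h3)]
    · rw [indicator_of_notMem h3, indicator_of_notMem (mt h2.2 h3)]
  · rw [indicator_of_notMem hu, indicator_of_notMem]
    exact fun h => hu ⟨hF0.trans_lt h.1, h.2⟩

omit [IsProbabilityMeasure P] in
lemma w_zero : M.w 0 = 0 := by simp [w]

lemma w_one (hθ : M.μ ≠ M.r) : M.w 1 = 1 := by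
  have h := M.w_one_sub_Fξ hθ 0
  have h2 : {ω | 0 < M.ξT ω} = univ := by ext ω; simp [M.ξT_pos ω]
  rw [M.Fξ_nonpos le_rfl, sub_zero, h2, setIntegral_univ] at h
  have h3 := M.meanξ_pos
  exact mul_right_cancel₀ h3.ne' (by rw [h, one_mul, meanξ])

lemma w_continuousOn (hθ : M.μ ≠ M.r) : ContinuousOn M.w (Icc 0 1) := by
  have h := intervalIntegral.continuousOn_primitive_interval' (M.intervalIntegrable_Gξ_one_sub hθ)
    left_mem_uIcc
  rw [uIcc_of_le zero_le_one] at h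
  exact (h.div_const M.meanξ).congr fun s hs => M.w_eq_intervalIntegral hs.1

lemma w_hasDerivAt (hθ : M.μ ≠ M.r) {p : ℝ} (hp : p ∈ Ioo (0 : ℝ) 1) :
    HasDerivAt M.w (M.Gξ (1 - p) / M.meanξ) p := by
  have hcont : ∀ q ∈ Ioo (0 : ℝ) 1, ContinuousAt (fun z => M.Gξ (1 - z)) q := fun q hq =>
    ContinuousAt.comp (f := fun z : ℝ => 1 - z)
      (M.Gξ_continuousAt hθ ⟨by linarith [hq.2], by linarith [hq.1]⟩) (by fun_prop)
  have h : HasDerivAt (fun u => ∫ z in 0..u, M.Gξ (1 - z)) (M.Gξ (1 - p)) p := by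
    refine intervalIntegral.integral_hasDerivAt_right
      ((M.intervalIntegrable_Gξ_one_sub hθ).mono_set ?_) ?_ (hcont p hp)
    · rw [uIcc_of_le zero_le_one, uIcc_of_le hp.1.le]
      exact Icc_subset_Icc le_rfl hp.2.le
    · exact ContinuousAt.stronglyMeasurableAtFilter isOpen_Ioo hcont p hp
  refine (h.div_const M.meanξ).congr_of_eventuallyEq ?_
  filter_upwards [Ioi_mem_nhds hp.1] with s hs
  exact M.w_eq_intervalIntegral (le_of_lt hs)

lemma w_strictMonoOn (hθ : M.μ ≠ M.r) : StrictMonoOn M.w (Icc 0 1) := by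
  refine strictMonoOn_of_deriv_pos (convex_Icc 0 1) (M.w_continuousOn hθ) fun p hp => ?_
  rw [interior_Icc] at hp
  rw [(M.w_hasDerivAt hθ hp).deriv]
  exact div_pos (M.Gξ_pos hθ ⟨by linarith [hp.2], by linarith [hp.1]⟩) M.meanξ_pos

lemma surjOn_w (hθ : M.μ ≠ M.r) : SurjOn M.w (Icc 0 1) (Icc 0 1) := by
  have h := intermediate_value_Icc zero_le_one (M.w_continuousOn hθ)
  rwa [M.w_zero, M.w_one hθ] at h

lemma wInv_w (hθ : M.μ ≠ M.r) {p : ℝ} (hp : p ∈ Icc (0 : ℝ) 1) : M.wInv (M.w p) = p :=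
  (M.w_strictMonoOn hθ).injOn.leftInvOn_invFunOn hp

lemma w_wInv (hθ : M.μ ≠ M.r) {s : ℝ} (hs : s ∈ Icc (0 : ℝ) 1) : M.w (M.wInv s) = s :=
  (M.surjOn_w hθ).rightInvOn_invFunOn hs

lemma wInv_mem_Icc (hθ : M.μ ≠ M.r) {s : ℝ} (hs : s ∈ Icc (0 : ℝ) 1) : M.wInv s ∈ Icc (0 : ℝ) 1 :=
  (M.surjOn_w hθ).mapsTo_invFunOn hs

lemma w_mem_Ioo (hθ : M.μ ≠ M.r) {p : ℝ} (hp : p ∈ Ioo (0 : ℝ) 1) : M.w p ∈ Ioo (0 : ℝ) 1 := by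
  have h := M.w_strictMonoOn hθ
  have h0 := h (left_mem_Icc.2 zero_le_one) (Ioo_subset_Icc_self hp) hp.1
  have h1 := h (Ioo_subset_Icc_self hp) (right_mem_Icc.2 zero_le_one) hp.2
  rw [M.w_zero] at h0
  rw [M.w_one hθ] at h1
  exact ⟨h0, h1⟩

lemma wInv_strictMonoOn (hθ : M.μ ≠ M.r) : StrictMonoOn M.wInv (Icc 0 1) := by
  intro s hs t ht hst
  rw [← (M.w_strictMonoOn hθ).lt_iff_lt (M.wInv_mem_Icc hθ hs) (M.wInv_mem_Icc hθ ht),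
    M.w_wInv hθ hs, M.w_wInv hθ ht]
  exact hst

lemma wInv_mem_Ioo (hθ : M.μ ≠ M.r) {s : ℝ} (hs : s ∈ Ioo (0 : ℝ) 1) :
    M.wInv s ∈ Ioo (0 : ℝ) 1 := by
  have hs' := Ioo_subset_Icc_self hs
  have h := M.wInv_mem_Icc hθ hs'
  have h2 := M.w_wInv hθ hs'
  refine ⟨lt_of_le_of_ne h.1 fun h0 => ?_, lt_of_le_of_ne h.2 fun h1 => ?_⟩
  · rw [← h0, M.w_zero] at h2
    exact hs.1.ne h2
  · rw [h1, M.w_one hθ] at h2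
    exact hs.2.ne h2.symm

lemma wInv_hasDerivAt (hθ : M.μ ≠ M.r) {s : ℝ} (hs : s ∈ Ioo (0 : ℝ) 1) :
    HasDerivAt M.wInv (M.meanξ / M.Gξ (1 - M.wInv s)) s := by
  have hp := M.wInv_mem_Ioo hθ hs
  have hG : 0 < M.Gξ (1 - M.wInv s) := M.Gξ_pos hθ ⟨by linarith [hp.2], by linarith [hp.1]⟩
  rw [← inv_div]
  refine HasDerivAt.of_local_left_inverse ?_ (M.w_hasDerivAt hθ hp)
    (div_pos hG M.meanξ_pos).ne' ?_
  · refine (M.wInv_strictMonoOn hθ).continuousAt_of_image_mem_nhds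
      (Icc_mem_nhds hs.1 hs.2) ?_
    refine Filter.mem_of_superset (Ioo_mem_nhds hp.1 hp.2) fun p hp' => ?_
    exact ⟨M.w p, Ioo_subset_Icc_self (M.w_mem_Ioo hθ hp'),
      M.wInv_w hθ (Ioo_subset_Icc_self hp')⟩
  · filter_upwards [Icc_mem_nhds hs.1 hs.2] with t ht
    exact M.w_wInv hθ ht

/-! ### The tangency condition as an equation for the lower threshold -/

lemma ξα_pos (hθ : M.μ ≠ M.r) {α : ℝ} (hα : α ∈ Ioo (0 : ℝ) 1) : 0 < M.ξα α :=
  M.Gξ_pos hθ ⟨by linarith [hα.2], by linarith [hα.1]⟩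

lemma Fξ_ξα (hθ : M.μ ≠ M.r) {α : ℝ} (hα : α ∈ Ioo (0 : ℝ) 1) : M.Fξ (M.ξα α) = 1 - α :=
  M.Fξ_Gξ hθ ⟨by linarith [hα.2], by linarith [hα.1]⟩

lemma measureReal_lt_ξT (y : ℝ) : P.real {ω | y < M.ξT ω} = 1 - M.Fξ y := by
  have h := probReal_compl_eq_one_sub (μ := P) (M.measurable_ξT (measurableSet_Iic (a := y)))
  have h2 : {ω | y < M.ξT ω} = (M.ξT ⁻¹' Iic y)ᶜ := by ext ω; simp
  rw [h2, h]
  rfl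

/-- `E[(ξ_T - y)⁺ ; ξ_T ≤ β]`. -/
noncomputable def truncCall (β y : ℝ) : ℝ := ∫ ω in {ω | M.ξT ω ≤ β}, max (M.ξT ω - y) 0 ∂P

omit [IsProbabilityMeasure P] in
lemma measurableSet_ξT_le (β : ℝ) : MeasurableSet {ω | M.ξT ω ≤ β} :=
  M.measurable_ξT measurableSet_Iic

lemma integrable_call (y : ℝ) : Integrable (fun ω => max (M.ξT ω - y) 0) P :=
  (M.integrable_ξT.sub (integrable_const y)).pos_part

lemma truncCall_antitone (β : ℝ) : Antitone (M.truncCall β) := by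
  intro y y' h
  refine integral_mono (M.integrable_call y').integrableOn (M.integrable_call y).integrableOn ?_
  intro ω
  exact max_le_max (by linarith) le_rfl

lemma truncCall_continuousOn (β : ℝ) : ContinuousOn (M.truncCall β) (Icc 0 β) := by
  refine continuousOn_of_dominated (bound := M.ξT) ?_ ?_ M.integrable_ξT.integrableOn ?_
  · exact fun y _ => (M.integrable_call y).integrableOn.aestronglyMeasurable
  · refine fun y hy => Filter.Eventually.of_forall fun ω => ?_
    rw [Real.norm_eq_abs, abs_of_nonneg (le_max_right _ _)]
    exact max_le (by linarith [hy.1]) (M.ξT_pos ω).le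
  · exact Filter.Eventually.of_forall fun ω => by fun_prop

/-- The equation of the lower threshold has exactly one solution: its left side decreases from a
positive number at `0` to `0` at `β`, its right side increases from `0` to `β`. -/
lemma existsUnique_truncCall_eq (hθ : M.μ ≠ M.r) {β lam : ℝ} (hβ : 0 < β) (hl : 0 < lam) :
    ∃! y, y ∈ Ioo 0 β ∧ lam * M.truncCall β y = y := by
  have hβ0 : M.truncCall β β = 0 := by
    refine (setIntegral_congr_fun (M.measurableSet_ξT_le β) fun ω hω => ?_).trans
      (integral_zero _ _)
    have : M.ξT ω ≤ β := hω
    exact max_eq_right (by linarith)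
  have h0 : 0 < M.truncCall β 0 := by
    rw [truncCall, setIntegral_pos_iff_support_of_nonneg_ae (f := fun ω => max (M.ξT ω - 0) 0)
      (Filter.Eventually.of_forall fun ω => le_max_right _ _) (M.integrable_call 0).integrableOn]
    refine (M.measure_ξT_mem_Ioo_pos hθ le_rfl hβ).trans_le (measure_mono fun ω hω => ⟨?_, ?_⟩)
    · simpa using M.ξT_pos ω
    · exact le_of_lt hω.2
  obtain ⟨y, hy, hy2⟩ := intermediate_value_Ioo' hβ.le
    (f := fun y => lam * M.truncCall β y - y)
    ((continuousOn_const.mul (M.truncCall_continuousOn β)).sub continuousOn_id)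
    (show (0 : ℝ) ∈ Ioo _ _ by
      constructor
      · simp only [hβ0]; linarith
      · simp only [sub_zero]; positivity)
  refine ⟨y, ⟨hy, by simpa [sub_eq_zero] using hy2⟩, ?_⟩
  rintro z ⟨hz, hz2⟩
  have hy3 : lam * M.truncCall β y = y := by simpa [sub_eq_zero] using hy2
  rcases lt_trichotomy z y with h | h | h
  · nlinarith [mul_le_mul_of_nonneg_left (M.truncCall_antitone β h.le) hl.le]
  · exact h
  · nlinarith [mul_le_mul_of_nonneg_left (M.truncCall_antitone β h.le) hl.le]

omit [IsProbabilityMeasure P] in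
lemma setOf_lt_ξT_diff {β y : ℝ} :
    {ω | y < M.ξT ω} \ {ω | β < M.ξT ω} = {ω | M.ξT ω ∈ Ioc y β} := by
  ext ω; simp

lemma truncCall_eq (hθ : M.μ ≠ M.r) {β y : ℝ} (hyβ : y ≤ β) :
    M.truncCall β y =
      (M.w (1 - M.Fξ y) - M.w (1 - M.Fξ β)) * M.meanξ - y * (M.Fξ β - M.Fξ y) := by
  have hsub : {ω | β < M.ξT ω} ⊆ {ω | y < M.ξT ω} := fun ω hω => hyβ.trans_lt hω
  have hm : ∀ y, MeasurableSet {ω | y < M.ξT ω} := fun y => M.measurable_ξT measurableSet_Ioi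
  have hmid : MeasurableSet {ω | M.ξT ω ∈ Ioc y β} := M.measurable_ξT measurableSet_Ioc
  have h1 : M.truncCall β y = ∫ ω in {ω | M.ξT ω ∈ Ioc y β}, (M.ξT ω - y) ∂P := by
    rw [truncCall, ← integral_indicator (M.measurableSet_ξT_le β), ← integral_indicator hmid]
    congr 1
    ext ω
    simp only [indicator, mem_ofPred_eq, mem_Ioc]
    split_ifs with h1 h2 h2
    · exact max_eq_left (by linarith)
    · exact max_eq_right (by
        have : ¬ y < M.ξT ω := fun h => h2 ⟨h, h1⟩
        linarith)
    · exact absurd h2.2 h1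
    · rfl
  have h2 : P.real {ω | M.ξT ω ∈ Ioc y β} = M.Fξ β - M.Fξ y := by
    rw [← M.setOf_lt_ξT_diff, measureReal_sdiff hsub (hm β), M.measureReal_lt_ξT,
      M.measureReal_lt_ξT]
    ring
  rw [h1, integral_sub M.integrable_ξT.integrableOn (integrable_const y).integrableOn, sub_mul,
    M.w_one_sub_Fξ hθ, M.w_one_sub_Fξ hθ, setIntegral_const, h2,
    ← M.setOf_lt_ξT_diff, setIntegral_sdiff (hm β) M.integrable_ξT.integrableOn hsub]
  simp [mul_comm]

lemma ξLow_mem (hθ : M.μ ≠ M.r) {α s : ℝ} (hα : α ∈ Ioo (0 : ℝ) 1) (hs : s ∈ Ioo (M.w α) 1) :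
    M.ξLow s ∈ Ioo 0 (M.ξα α) := by
  have hw := M.w_mem_Ioo hθ hα
  have hs' : s ∈ Ioo (0 : ℝ) 1 := ⟨hw.1.trans hs.1, hs.2⟩
  have hp := M.wInv_mem_Ioo hθ hs'
  have hαp : α < M.wInv s := by
    have := M.wInv_strictMonoOn hθ (Ioo_subset_Icc_self hw) (Ioo_subset_Icc_self hs') hs.1
    rwa [M.wInv_w hθ (Ioo_subset_Icc_self hα)] at this
  exact ⟨M.Gξ_pos hθ ⟨by linarith [hp.2], by linarith [hp.1]⟩,
    M.Gξ_strictMonoOn hθ ⟨by linarith [hp.2], by linarith [hp.1]⟩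
      ⟨by linarith [hα.2], by linarith [hα.1]⟩ (by linarith)⟩

lemma Fξ_ξLow (hθ : M.μ ≠ M.r) {s : ℝ} (hs : s ∈ Ioo (0 : ℝ) 1) :
    M.Fξ (M.ξLow s) = 1 - M.wInv s := by
  have hp := M.wInv_mem_Ioo hθ hs
  exact M.Fξ_Gξ hθ ⟨by linarith [hp.2], by linarith [hp.1]⟩

omit [IsProbabilityMeasure P] in
lemma φLeft_dirac_of_lt {α s : ℝ} (hα : 0 ≤ α) (lam : ℝ) (h : α < M.wInv s) :
    M.φLeft (Measure.dirac α) lam s = (1 + lam * M.wInv s) / (1 + lam) := by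
  have : (Measure.dirac α).real (Ico 0 (M.wInv s)) = 1 := by
    rw [measureReal_def, Measure.dirac_apply' _ measurableSet_Ico, indicator_of_mem (mem_Ico.2 ⟨hα, h⟩)]
    simp
  rw [φLeft, this]

lemma φLeft_dirac_w (hθ : M.μ ≠ M.r) {α : ℝ} (hα : α ∈ Ioo (0 : ℝ) 1) (lam : ℝ) :
    M.φLeft (Measure.dirac α) lam (M.w α) = lam * α / (1 + lam) := by
  have : (Measure.dirac α).real (Ico 0 α) = 0 := by
    rw [measureReal_def, Measure.dirac_apply' _ measurableSet_Ico, indicator_of_notMem (by simp)]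
    simp
  rw [φLeft, M.wInv_w hθ (Ioo_subset_Icc_self hα), this, zero_add]

/-- The slope of `φ(·-; λ)` at `s` is `λ E[ξ_T] / ((1 + λ) ξLow s)`, and the slope of the chord is
computed from tail expectations; equating them gives the equation of the lower threshold. -/
lemma isTangency_iff (hθ : M.μ ≠ M.r) {α lam s : ℝ} (hα : α ∈ Ioo (0 : ℝ) 1) (hl : 0 < lam) :
    M.IsTangency (Measure.dirac α) α lam s ↔
      s ∈ Ioo (M.w α) 1 ∧ lam * M.truncCall (M.ξα α) (M.ξLow s) = M.ξLow s := by
  refine and_congr_right fun hs => ?_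
  have hw := M.w_mem_Ioo hθ hα
  have hs' : s ∈ Ioo (0 : ℝ) 1 := ⟨hw.1.trans hs.1, hs.2⟩
  have hαp : ∀ t ∈ Ioo (M.w α) 1, α < M.wInv t := fun t ht => by
    have ht' : t ∈ Icc (0 : ℝ) 1 := ⟨hw.1.le.trans ht.1.le, ht.2.le⟩
    have := M.wInv_strictMonoOn hθ (Ioo_subset_Icc_self hw) ht' ht.1
    rwa [M.wInv_w hθ (Ioo_subset_Icc_self hα)] at this
  have hder : HasDerivAt (M.φLeft (Measure.dirac α) lam)
      (lam * (M.meanξ / M.ξLow s) / (1 + lam)) s := by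
    refine ((((M.wInv_hasDerivAt hθ hs').const_mul lam).const_add 1).div_const
      (1 + lam)).congr_of_eventuallyEq ?_
    filter_upwards [Ioo_mem_nhds hs.1 hs.2] with t ht
    exact M.φLeft_dirac_of_lt hα.1.le lam (hαp t ht)
  have hlow := M.ξLow_mem hθ hα hs
  have hq : s - M.w α ≠ 0 := sub_ne_zero.2 hs.1.ne'
  have hkey : M.truncCall (M.ξα α) (M.ξLow s) =
      (s - M.w α) * M.meanξ - M.ξLow s * (M.wInv s - α) := by
    rw [M.truncCall_eq hθ hlow.2.le, M.Fξ_ξα hθ hα, M.Fξ_ξLow hθ hs', sub_sub_cancel,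
      sub_sub_cancel, M.w_wInv hθ (Ioo_subset_Icc_self hs')]
    ring
  have hl1 : 1 + lam ≠ 0 := by positivity
  have hlow0 := hlow.1.ne'
  rw [M.φLeft_dirac_of_lt hα.1.le lam (hαp s hs), M.φLeft_dirac_w hθ hα, hkey]
  have halg : lam * (M.meanξ / M.ξLow s) / (1 + lam) =
      ((1 + lam * M.wInv s) / (1 + lam) - lam * α / (1 + lam)) / (s - M.w α) ↔
      lam * ((s - M.w α) * M.meanξ - M.ξLow s * (M.wInv s - α)) = M.ξLow s := by
    rw [← sub_div, div_div, mul_div_assoc', div_div, div_eq_div_iff (by positivity)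
      (mul_ne_zero hl1 hq)]
    constructor
    · intro h
      have h2 : (1 + lam) * (lam * M.meanξ * (s - M.w α)) =
          (1 + lam) * ((1 + lam * M.wInv s - lam * α) * M.ξLow s) := by linarith
      have := mul_left_cancel₀ hl1 h2
      linarith
    · intro h
      linear_combination (1 + lam) * h
  rw [← halg]
  constructor
  · exact fun h => hder.unique h
  · exact fun h => h ▸ hder

/-- The tangency point exists and is unique. -/
lemma existsUnique_isTangency (hθ : M.μ ≠ M.r) {α lam : ℝ} (hα : α ∈ Ioo (0 : ℝ) 1)
    (hl : 0 < lam) : ∃! s, M.IsTangency (Measure.dirac α) α lam s := by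
  obtain ⟨y, ⟨hy, hy2⟩, huniq⟩ := M.existsUnique_truncCall_eq hθ (M.ξα_pos hθ hα) hl
  have hFy : 1 - M.Fξ y ∈ Ioo (0 : ℝ) 1 :=
    ⟨by linarith [M.Fξ_lt_one hθ hy.1], by linarith [M.Fξ_pos hθ hy.1]⟩
  have hlow : M.ξLow (M.w (1 - M.Fξ y)) = y := by
    rw [ξLow, M.wInv_w hθ (Ioo_subset_Icc_self hFy), sub_sub_cancel, M.Gξ_Fξ hθ hy.1]
  refine ⟨M.w (1 - M.Fξ y), (M.isTangency_iff hθ hα hl).2 ⟨⟨?_, (M.w_mem_Ioo hθ hFy).2⟩, ?_⟩, ?_⟩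
  · refine M.w_strictMonoOn hθ (Ioo_subset_Icc_self hα) (Ioo_subset_Icc_self hFy) ?_
    have := M.Fξ_lt hθ hy.1.le hy.2
    rw [M.Fξ_ξα hθ hα] at this
    linarith
  · rw [hlow, hy2]
  · intro s hs
    obtain ⟨hs1, hs2⟩ := (M.isTangency_iff hθ hα hl).1 hs
    have hs' : s ∈ Ioo (0 : ℝ) 1 := ⟨(M.w_mem_Ioo hθ hα).1.trans hs1.1, hs1.2⟩
    have h := huniq _ ⟨M.ξLow_mem hθ hα hs1, hs2⟩
    rw [← h, M.Fξ_ξLow hθ hs', sub_sub_cancel, M.w_wInv hθ (Ioo_subset_Icc_self hs')]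

end Market

end MeanWVaR

namespace MeanWVaR

variable {Ω : Type*} [MeasurableSpace Ω]

/-! ### Extended-real integrals and quantiles -/

lemma eIntegral_congr_ae {ν : Measure Ω} {f g : Ω → EReal} (h : f =ᵐ[ν] g) :
    eIntegral ν f = eIntegral ν g := by
  have h1 : ∫⁻ a, (f a).toENNReal ∂ν = ∫⁻ a, (g a).toENNReal ∂ν :=
    lintegral_congr_ae (h.mono fun a ha => by simp only [ha])
  have h2 : ∫⁻ a, (-f a).toENNReal ∂ν = ∫⁻ a, (-g a).toENNReal ∂ν :=
    lintegral_congr_ae (h.mono fun a ha => by simp only [ha])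
  rw [eIntegral, eIntegral, h1, h2]

lemma eIntegral_coe {ν : Measure Ω} {f : Ω → ℝ} (hf : Integrable f ν) :
    eIntegral ν (fun a => (f a : EReal)) = ((∫ a, f a ∂ν : ℝ) : EReal) := by
  have h1 : ∫⁻ a, ENNReal.ofReal (f a) ∂ν ≠ ⊤ := hf.lintegral_lt_top.ne
  have h2 : ∫⁻ a, ENNReal.ofReal (-f a) ∂ν ≠ ⊤ := hf.neg.lintegral_lt_top.ne
  rw [integral_eq_lintegral_pos_part_sub_lintegral_neg_part hf, EReal.coe_sub, eIntegral]
  simp only [← EReal.coe_neg, EReal.real_coe_toENNReal]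
  rw [EReal.coe_ennreal_toReal h1, EReal.coe_ennreal_toReal h2]

lemma eIntegral_eq_bot {ν : Measure Ω} {f : Ω → EReal}
    (h : ∫⁻ a, (-f a).toENNReal ∂ν = ⊤) : eIntegral ν f = ⊥ := by
  rw [eIntegral, h, EReal.coe_ennreal_top, sub_eq_add_neg, EReal.neg_top, EReal.add_bot]

lemma wvar_dirac (P : Measure Ω) {α : ℝ} (hα : α ∈ Icc (0 : ℝ) 1) (R : Ω → EReal) :
    wvar P (Measure.dirac α) R = -quantile P R α := by
  have h1 : (Measure.dirac α).restrict (Icc (0 : ℝ) 1) = Measure.dirac α := by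
    classical
    rw [restrict_dirac, if_pos hα]
  rw [wvar, h1, eIntegral, lintegral_dirac, lintegral_dirac]
  congr 1
  induction quantile P R α with
  | bot => simp
  | top => simp
  | coe y =>
    rw [← EReal.coe_neg, EReal.real_coe_toENNReal, EReal.real_coe_toENNReal,
      EReal.coe_ennreal_ofReal, EReal.coe_ennreal_ofReal, ← EReal.coe_sub]
    congr 1
    exact max_zero_sub_max_neg_zero_eq_self y

/-- A real number is below the upper quantile at `α` iff the variable stays strictly below it with
probability at most `α`. -/
lemma coe_le_quantile_iff (P : Measure Ω) [IsFiniteMeasure P] {α : ℝ} (hα : α < 1) (R : Ω → EReal)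
    (g : ℝ) : (g : EReal) ≤ quantile P R α ↔ P.real {ω | R ω < (g : EReal)} ≤ α := by
  rw [quantile, if_pos hα, upperQuantile, le_sInf_iff]
  constructor
  · intro h
    obtain ⟨u, humono, hug, hulim⟩ := exists_seq_strictMono_tendsto g
    have hU : {ω | R ω < (g : EReal)} = ⋃ n, {ω | R ω ≤ (u n : EReal)} := by
      ext ω
      simp only [mem_ofPred_eq, mem_iUnion]
      constructor
      · intro hω
        obtain ⟨z, hz1, hz2⟩ := EReal.lt_iff_exists_real_btwn.1 hω
        obtain ⟨n, hn⟩ := (hulim.eventually (lt_mem_nhds (EReal.coe_lt_coe_iff.1 hz2))).exists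
        exact ⟨n, hz1.le.trans (EReal.coe_le_coe_iff.2 hn.le)⟩
      · rintro ⟨n, hn⟩
        exact hn.trans_lt (EReal.coe_lt_coe_iff.2 (hug n))
    have hmono : Monotone fun n => {ω | R ω ≤ (u n : EReal)} := by
      intro m n hmn ω hω
      exact le_trans hω (EReal.coe_le_coe_iff.2 (humono.monotone hmn))
    have hlim := tendsto_measure_iUnion_atTop (μ := P) hmono
    rw [← hU] at hlim
    have hlim2 := (ENNReal.tendsto_toReal (measure_ne_top P _)).comp hlim
    refine le_of_tendsto hlim2 (Filter.Eventually.of_forall fun n => ?_)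
    by_contra! hlt
    have := h _ ⟨u n, hlt, rfl⟩
    exact absurd (EReal.coe_le_coe_iff.1 this) (not_le.2 (hug n))
  · rintro h _ ⟨y, hy, rfl⟩
    refine EReal.coe_le_coe_iff.2 (not_lt.1 fun hlt => ?_)
    have : P.real {ω | R ω ≤ (y : EReal)} ≤ P.real {ω | R ω < (g : EReal)} :=
      measureReal_mono fun ω hω => lt_of_le_of_lt hω (EReal.coe_lt_coe_iff.2 hlt)
    exact absurd (this.trans h) (not_le.2 hy)

lemma quantile_le_coe (P : Measure Ω) {α : ℝ} (hα : α < 1) {R : Ω → EReal} {y : ℝ}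
    (h : α < P.real {ω | R ω ≤ (y : EReal)}) : quantile P R α ≤ (y : EReal) := by
  rw [quantile, if_pos hα]
  exact sInf_le ⟨y, h, rfl⟩

namespace Market

variable {P : Measure Ω} (M : Market P)

/-! ### Log-returns -/

lemma R_of_pos {x : ℝ} (hx : 0 < x) {X : Ω → ℝ} {ω : Ω} (h : 0 < X ω) :
    M.R x X ω = ((1 / M.T * Real.log (X ω / x) : ℝ) : EReal) := by
  rw [R, logReturn, ENNReal.log_ofReal_of_pos (div_pos h hx), EReal.coe_mul]

lemma R_of_nonpos {x : ℝ} (hx : 0 < x) {X : Ω → ℝ} {ω : Ω} (h : X ω ≤ 0) : M.R x X ω = ⊥ := by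
  rw [R, logReturn, ENNReal.log_ofReal, if_pos (div_nonpos_of_nonpos_of_nonneg h hx.le),
    EReal.coe_mul_bot_of_pos (one_div_pos.2 M.T_pos)]

lemma R_lt_iff {x : ℝ} (hx : 0 < x) (X : Ω → ℝ) (ω : Ω) {c : ℝ} (hc : 0 < c) :
    M.R x X ω < ((1 / M.T * Real.log (c / x) : ℝ) : EReal) ↔ X ω < c := by
  rcases le_or_gt (X ω) 0 with h | h
  · rw [M.R_of_nonpos hx h]
    simp only [EReal.bot_lt_coe, true_iff]
    linarith
  · rw [M.R_of_pos hx h, EReal.coe_lt_coe_iff, mul_lt_mul_iff_right₀ (one_div_pos.2 M.T_pos),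
      Real.log_lt_log_iff (div_pos h hx) (div_pos hc hx), div_lt_div_iff_of_pos_right hx]

lemma R_le_iff {x : ℝ} (hx : 0 < x) (X : Ω → ℝ) (ω : Ω) {c : ℝ} (hc : 0 < c) :
    M.R x X ω ≤ ((1 / M.T * Real.log (c / x) : ℝ) : EReal) ↔ X ω ≤ c := by
  rcases le_or_gt (X ω) 0 with h | h
  · rw [M.R_of_nonpos hx h]
    simp only [bot_le, true_iff]
    linarith
  · rw [M.R_of_pos hx h, EReal.coe_le_coe_iff, mul_le_mul_iff_right₀ (one_div_pos.2 M.T_pos),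
      Real.log_le_log_iff (div_pos h hx) (div_pos hc hx), div_le_div_iff_of_pos_right hx]

/-- Every real number is the log-return of a positive wealth. -/
lemma exists_logReturn_eq {x : ℝ} (hx : 0 < x) (g : ℝ) :
    ∃ c, 0 < c ∧ 1 / M.T * Real.log (c / x) = g := by
  refine ⟨x * Real.exp (M.T * g), by positivity, ?_⟩
  rw [mul_div_cancel_left₀ _ hx.ne', Real.log_exp, one_div_mul_eq_div,
    mul_div_cancel_left₀ _ M.T_pos.ne']

lemma measureReal_le_not_lt [IsProbabilityMeasure P] {X : Ω → ℝ} (hX : Measurable X) {c a : ℝ}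
    (h : P.real {ω | X ω < c} ≤ a) : 1 - a ≤ P.real {ω | c ≤ X ω} := by
  have h2 := probReal_compl_eq_one_sub (μ := P) (hX (measurableSet_Iio (a := c)))
  have h3 : {ω | c ≤ X ω} = (X ⁻¹' Iio c)ᶜ := by ext ω; simp
  rw [h3, h2]
  have : P.real (X ⁻¹' Iio c) ≤ a := h
  linarith

lemma Feasible.integrable {x : ℝ} {X : Ω → ℝ} (h : M.Feasible x X) :
    Integrable (fun ω => M.ξT ω * X ω) P := by
  refine ⟨(M.measurable_ξT.mul h.measurable).aestronglyMeasurable, ?_⟩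
  rw [hasFiniteIntegral_iff_ofReal
    (h.nonneg.mono fun ω hω => mul_nonneg (M.ξT_pos ω).le hω)]
  exact h.budget.trans_lt ENNReal.ofReal_lt_top

lemma Feasible.integral_le {x : ℝ} (hx : 0 < x) {X : Ω → ℝ} (h : M.Feasible x X) :
    ∫ ω, M.ξT ω * X ω ∂P ≤ x := by
  rw [integral_eq_lintegral_of_nonneg_ae
    (h.nonneg.mono fun ω hω => mul_nonneg (M.ξT_pos ω).le hω)
    (M.measurable_ξT.mul h.measurable).aestronglyMeasurable]
  exact ENNReal.toReal_le_of_le_ofReal hx.le h.budget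

lemma feasible_of_integral_le {x : ℝ} {X : Ω → ℝ} (hX : Measurable X) (h0 : ∀ ω, 0 ≤ X ω)
    (hi : Integrable (fun ω => M.ξT ω * X ω) P) (h : ∫ ω, M.ξT ω * X ω ∂P ≤ x) :
    M.Feasible x X := by
  refine ⟨hX, Filter.Eventually.of_forall h0, ?_⟩
  rw [← ofReal_integral_eq_lintegral_ofReal hi
    (Filter.Eventually.of_forall fun ω => mul_nonneg (M.ξT_pos ω).le (h0 ω))]
  exact ENNReal.ofReal_le_ofReal h

lemma expect_R_of_integrable [IsProbabilityMeasure P] {x : ℝ} (hx : 0 < x) {X : Ω → ℝ}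
    (hpos : ∀ᵐ ω ∂P, 0 < X ω) (hi : Integrable (fun ω => Real.log (X ω)) P) :
    expect P (M.R x X) =
      ((1 / M.T * (∫ ω, Real.log (X ω) ∂P - Real.log x) : ℝ) : EReal) := by
  have h1 : M.R x X =ᵐ[P] fun ω => ((1 / M.T * (Real.log (X ω) - Real.log x) : ℝ) : EReal) := by
    filter_upwards [hpos] with ω hω
    rw [M.R_of_pos hx hω, Real.log_div hω.ne' hx.ne']
  have h2 : Integrable (fun ω => 1 / M.T * (Real.log (X ω) - Real.log x)) P :=
    (hi.sub (integrable_const _)).const_mul _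
  rw [expect, eIntegral_congr_ae h1, eIntegral_coe h2, integral_const_mul,
    integral_sub hi (integrable_const _)]
  simp

/-- An admissible wealth whose expected log-return is not `-∞` is a.s. positive with integrable
logarithm. The positive part is no obstacle: `log X ≤ ξ_T X - 1 - log ξ_T`. -/
lemma Feasible.integrable_log [IsProbabilityMeasure P] {x : ℝ} (hx : 0 < x) {X : Ω → ℝ}
    (h : M.Feasible x X) (hE : expect P (M.R x X) ≠ ⊥) :
    (∀ᵐ ω ∂P, 0 < X ω) ∧ Integrable (fun ω => Real.log (X ω)) P := by
  have hfin : ∫⁻ ω, (-M.R x X ω).toENNReal ∂P ≠ ⊤ := fun h => hE (eIntegral_eq_bot h)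
  have hmeas : Measurable (M.R x X) := by
    have : Measurable fun ω => ENNReal.log (ENNReal.ofReal (X ω / x)) :=
      ENNReal.measurable_log.comp ((h.measurable.div_const x).ennreal_ofReal)
    exact measurable_const.mul this
  have hpos : ∀ᵐ ω ∂P, 0 < X ω := by
    have := ae_lt_top (hmeas.neg.ereal_toENNReal) hfin
    filter_upwards [this] with ω hω
    by_contra hle
    rw [Pi.neg_apply, M.R_of_nonpos hx (not_lt.1 hle)] at hω
    simp at hω
  refine ⟨hpos, ?_⟩
  set f : Ω → ℝ := fun ω => 1 / M.T * Real.log (X ω / x) with hf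
  have hfm : Measurable f := ((h.measurable.div_const x).log).const_mul _
  have hneg : Integrable (fun ω => max (-f ω) 0) P := by
    refine ⟨(hfm.neg.max measurable_const).aestronglyMeasurable, ?_⟩
    rw [hasFiniteIntegral_iff_ofReal (f := fun ω => max (-f ω) 0)
      (Filter.Eventually.of_forall fun ω => le_max_right _ _)]
    refine lt_of_le_of_lt (le_of_eq (lintegral_congr_ae ?_)) (lt_top_iff_ne_top.2 hfin)
    filter_upwards [hpos] with ω hω
    rw [M.R_of_pos hx hω, ← EReal.coe_neg, EReal.real_coe_toENNReal]
    change ENNReal.ofReal (max (-f ω) 0) = ENNReal.ofReal (-f ω)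
    rcases le_total (-f ω) 0 with h0 | h0
    · rw [max_eq_right h0, ENNReal.ofReal_zero, ENNReal.ofReal_of_nonpos h0]
    · rw [max_eq_left h0]
  have hup : Integrable (fun ω => 1 / M.T *
      (|M.ξT ω * X ω| + 1 + |Real.log (M.ξT ω)| + |Real.log x|)) P :=
    (((h.integrable.abs.add (integrable_const 1)).add M.integrable_log_ξT.abs).add
      (integrable_const _)).const_mul _
  have hfi : Integrable f P := by
    refine (hneg.add hup).mono' hfm.aestronglyMeasurable ?_
    filter_upwards [hpos] with ω hω
    have hT := one_div_pos.2 M.T_pos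
    have h1 : f ω ≤ 1 / M.T * (|M.ξT ω * X ω| + 1 + |Real.log (M.ξT ω)| + |Real.log x|) := by
      refine mul_le_mul_of_nonneg_left ?_ hT.le
      have h2 := Real.log_le_sub_one_of_pos (mul_pos (M.ξT_pos ω) hω)
      rw [Real.log_mul (M.ξT_pos ω).ne' hω.ne'] at h2
      rw [Real.log_div hω.ne' hx.ne']
      linarith [le_abs_self (M.ξT ω * X ω), neg_abs_le (Real.log (M.ξT ω)),
        neg_abs_le (Real.log x)]
    have h3 : 0 ≤ 1 / M.T * (|M.ξT ω * X ω| + 1 + |Real.log (M.ξT ω)| + |Real.log x|) := by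
      positivity
    rw [Real.norm_eq_abs, abs_le]
    simp only [Pi.add_apply]
    constructor
    · linarith [le_max_left (-f ω) 0]
    · linarith [le_max_right (-f ω) 0]
  refine ((hfi.const_mul M.T).add (integrable_const (Real.log x))).congr ?_
  filter_upwards [hpos] with ω hω
  simp only [hf, Pi.add_apply]
  rw [Real.log_div hω.ne' hx.ne', ← mul_assoc, mul_one_div_cancel M.T_pos.ne']
  ring

lemma objective_dirac {α : ℝ} (hα : α ∈ Icc (0 : ℝ) 1) (lam x : ℝ) (X : Ω → ℝ) :
    M.objective (Measure.dirac α) lam x X =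
      (lam : EReal) * expect P (M.R x X) + quantile P (M.R x X) α := by
  rw [objective, wvar_dirac P hα, sub_eq_add_neg, neg_neg]

end Market

end MeanWVaR

namespace MeanWVaR

/-! ### The pointwise Lagrangian inequality -/

/-- `g(t) = max_{Y > 0} (log Y - Y) - max_{Y ≥ t} (log Y - Y)`: the price, in units of
log-utility, of forcing a normalised wealth to be at least `t`. -/
noncomputable def floorCost (t : ℝ) : ℝ := max t 1 - 1 - Real.log (max t 1)

lemma floorCost_of_le {t : ℝ} (h : t ≤ 1) : floorCost t = 0 := by
  simp [floorCost, max_eq_right h]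

lemma floorCost_of_ge {t : ℝ} (h : 1 ≤ t) : floorCost t = t - 1 - Real.log t := by
  rw [floorCost, max_eq_left h]

lemma sub_one_sub_log_lt {s t : ℝ} (hs : 1 ≤ s) (hst : s < t) :
    s - 1 - Real.log s < t - 1 - Real.log t := by
  have hs0 : 0 < s := by linarith
  have h1 := Real.log_lt_sub_one_of_pos (div_pos (hs0.trans hst) hs0)
    (by rw [Ne, div_eq_one_iff_eq hs0.ne']; exact hst.ne')
  rw [Real.log_div (hs0.trans hst).ne' hs0.ne'] at h1
  have h2 : t / s - 1 ≤ t - s := by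
    rw [div_sub_one hs0.ne', div_le_iff₀ hs0]
    nlinarith
  linarith

lemma floorCost_lt {s t : ℝ} (hst : s < t) (ht : 1 < t) : floorCost s < floorCost t := by
  rw [floorCost, floorCost, max_eq_left ht.le]
  exact sub_one_sub_log_lt (le_max_right _ _) (max_lt hst ht)

lemma floorCost_mono : Monotone floorCost := by
  intro s t h
  rcases le_or_gt t 1 with ht | ht
  · rw [floorCost_of_le ht, floorCost_of_le (h.trans ht)]
  · rcases h.eq_or_lt with rfl | h
    · exact le_rfl
    · exact (floorCost_lt h ht).le

lemma floorCost_nonneg (t : ℝ) : 0 ≤ floorCost t := by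
  have := floorCost_mono (min_le_left t 1)
  rwa [floorCost_of_le (min_le_right t 1)] at this

/-- On `Y ≥ t` the function `log Y - Y` is at most `-1 - g(t)`, attained only at `max t 1`. -/
lemma log_sub_le_floorCost {t Y : ℝ} (hY : 0 < Y) (htY : t ≤ Y) :
    Real.log Y - Y ≤ -1 - floorCost t ∧
      (Real.log Y - Y = -1 - floorCost t → Y = max t 1) := by
  rcases le_or_gt t 1 with ht | ht
  · rw [floorCost_of_le ht, max_eq_right ht]
    refine ⟨by linarith [Real.log_le_sub_one_of_pos hY], fun h => ?_⟩
    by_contra hne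
    linarith [Real.log_lt_sub_one_of_pos hY hne]
  · rw [floorCost_of_ge ht.le, max_eq_left ht.le]
    rcases htY.eq_or_lt with rfl | hlt
    · exact ⟨by linarith, fun _ => rfl⟩
    · have := sub_one_sub_log_lt ht.le hlt
      exact ⟨by linarith, fun h => by linarith⟩

/-- For a ratio `τ > 1`, raising the floor by the factor `ρ` does not pay: the gain
`(τ - 1) log ρ` is at most the additional cost of the floor. -/
lemma floor_tradeoff {τ ρ : ℝ} (hτ : 1 < τ) (hρ : 0 < ρ) :
    -1 - floorCost (τ * ρ) + (τ - 1) * Real.log ρ ≤ Real.log τ - τ ∧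
      (-1 - floorCost (τ * ρ) + (τ - 1) * Real.log ρ = Real.log τ - τ → ρ = 1) := by
  have hτ0 : 0 < τ := by linarith
  rcases le_or_gt 1 (τ * ρ) with h | h
  · rw [floorCost_of_ge h, Real.log_mul hτ0.ne' hρ.ne']
    refine ⟨by nlinarith [Real.log_le_sub_one_of_pos hρ], fun heq => ?_⟩
    by_contra hne
    nlinarith [Real.log_lt_sub_one_of_pos hρ hne]
  · rw [floorCost_of_le h.le]
    have h1 : Real.log τ + Real.log ρ < 0 := by
      rw [← Real.log_mul hτ0.ne' hρ.ne']
      exact Real.log_neg (mul_pos hτ0 hρ) h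
    -- `log τ > 1 - 1 / τ`
    have h2 : τ - 1 ≤ τ * Real.log τ := by
      have h3 := Real.log_le_sub_one_of_pos (inv_pos.2 hτ0)
      rw [Real.log_inv] at h3
      have h4 : τ * τ⁻¹ = 1 := mul_inv_cancel₀ hτ0.ne'
      nlinarith
    have h5 : (τ - 1) * (Real.log τ + Real.log ρ) < 0 :=
      mul_neg_of_pos_of_neg (by linarith) h1
    exact ⟨by nlinarith, fun heq => by nlinarith⟩

/-- The function `ξ / l - 1` on `l < ξ ≤ β`, zero elsewhere. With mean `1 / λ` under the law of
`ξ_T`, it spreads the reward for the logarithm of the floor over the states in which the floor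
binds. -/
noncomputable def midDensity (l β ξ : ℝ) : ℝ := if ξ ≤ β then max (ξ / l - 1) 0 else 0

/-- Value of the Lagrangian at a state with price density `ξ`: log-utility of the
wealth `X` minus its price, plus the multiplier of the probability constraint on the floor `c`,
plus this state's share of the reward for the level of the floor. -/
noncomputable def lagrangian (l β b e c ξ X : ℝ) : ℝ :=
  Real.log X - ξ * X / b +
    e * ((if c ≤ X then 1 else 0) - (if ξ ≤ β then 1 else 0)) +
    midDensity l β ξ * Real.log c

/-- The optimal wealth at a state with price density `ξ`. -/
noncomputable def optWealth (l β b ξ : ℝ) : ℝ :=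
  if β < ξ then b / ξ else if l < ξ then b / l else b / ξ

section Pointwise

variable {l β b c ξ X : ℝ}

lemma optWealth_pos (hl : 0 < l) (hb : 0 < b) (hξ : 0 < ξ) : 0 < optWealth l β b ξ := by
  unfold optWealth
  split_ifs <;> positivity

/-- The optimal wealth is at least the floor `b / l` exactly on `ξ ≤ β`. -/
lemma div_le_optWealth_iff (hl : 0 < l) (hlβ : l < β) (hb : 0 < b) (hξ : 0 < ξ) :
    b / l ≤ optWealth l β b ξ ↔ ξ ≤ β := by
  unfold optWealth
  split_ifs with h1 h2
  · rw [div_le_div_iff_of_pos_left hb hl hξ]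
    exact iff_of_false (by linarith) (by linarith)
  · simpa using h1
  · rw [div_le_div_iff_of_pos_left hb hl hξ]
    exact iff_of_true (by linarith) (by linarith)

lemma lagrangian_optWealth (hl : 0 < l) (hlβ : l < β) (hb : 0 < b) (hξ : 0 < ξ) (e : ℝ) :
    lagrangian l β b e (b / l) ξ (optWealth l β b ξ) =
      Real.log (optWealth l β b ξ) - ξ * optWealth l β b ξ / b +
        midDensity l β ξ * Real.log (b / l) := by
  rw [lagrangian]
  simp only [div_le_optWealth_iff hl hlβ hb hξ, sub_self, mul_zero, add_zero]

/-- The Lagrangian with multiplier `g(β c / b)` is maximised by the optimal wealth with floor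
`b / l`. Equality at a state in the middle region forces the floor to be `b / l`; and for that
floor, equality outside `ξ = β` forces the wealth to be the optimal one. -/
lemma lagrangian_le (hl : 0 < l) (hlβ : l < β) (hb : 0 < b) (hc : 0 < c) (hξ : 0 < ξ)
    (hX : 0 < X) :
    lagrangian l β b (floorCost (β * c / b)) c ξ X ≤
      lagrangian l β b (floorCost (β * c / b)) (b / l) ξ (optWealth l β b ξ) ∧
    (lagrangian l β b (floorCost (β * c / b)) c ξ X =
        lagrangian l β b (floorCost (β * c / b)) (b / l) ξ (optWealth l β b ξ) →
      (ξ ∈ Ioc l β → c = b / l) ∧ (c = b / l → ξ ≠ β → X = optWealth l β b ξ)) := by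
  rw [lagrangian_optWealth hl hlβ hb hξ, lagrangian, midDensity]
  set Y := ξ * X / b with hY
  have hY0 : 0 < Y := by positivity
  have hlogX : Real.log X = Real.log Y + Real.log (b / ξ) := by
    rw [← Real.log_mul hY0.ne' (by positivity)]
    congr 1
    rw [hY]; field_simp
  have hXY : X = Y * (b / ξ) := by rw [hY]; field_simp
  have hfloor : c ≤ X → ξ * c / b ≤ Y := fun h => by rw [hY]; gcongr
  have huA := fun h : c ≤ X => log_sub_le_floorCost hY0 (hfloor h)
  have hu0 : Real.log Y - Y ≤ -1 ∧ (Real.log Y - Y = -1 → Y = 1) := by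
    refine ⟨by linarith [Real.log_le_sub_one_of_pos hY0], fun h => ?_⟩
    by_contra hne
    linarith [Real.log_lt_sub_one_of_pos hY0 hne]
  have hβl : c = b / l → 1 < β * c / b := by
    rintro rfl
    rw [mul_div_assoc', mul_comm, mul_div_assoc, mul_div_cancel_left₀ _ hb.ne', one_lt_div hl]
    exact hlβ
  have hξl : c = b / l → ξ * c / b = ξ / l := by
    rintro rfl
    field_simp
  have hmono : ∀ {s t : ℝ}, s ≤ t → floorCost (s * c / b) ≤ floorCost (t * c / b) :=
    fun h => floorCost_mono (by gcongr)
  have hstrict : ∀ {s t : ℝ}, s < t → 1 < t * c / b →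
      floorCost (s * c / b) < floorCost (t * c / b) :=
    fun h => floorCost_lt (by gcongr)
  have hgβ := floorCost_nonneg (β * c / b)
  have hgξ := floorCost_nonneg (ξ * c / b)
  rcases lt_or_ge β ξ with h1 | h1
  · -- expensive states: no floor is needed
    have hopt : optWealth l β b ξ = b / ξ := by rw [optWealth, if_pos h1]
    have hone : ξ * (b / ξ) / b = 1 := by field_simp
    rw [hopt, hone, if_neg h1.not_ge, if_neg h1.not_ge, hlogX]
    by_cases hA : c ≤ X
    · rw [if_pos hA]
      have h2 := (huA hA).1
      have h3 := hmono h1.le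
      refine ⟨by linarith, fun h => ⟨fun hm => absurd hm.2 h1.not_ge, fun hcl _ => ?_⟩⟩
      have h4 := hstrict h1 ((hβl hcl).trans_le (by gcongr))
      linarith
    · rw [if_neg hA]
      refine ⟨by linarith, fun h => ⟨fun hm => absurd hm.2 h1.not_ge, fun hcl _ => ?_⟩⟩
      rw [hXY, hu0.2 (by linarith), one_mul]
  · rcases lt_or_ge l ξ with h2 | h2
    · -- middle states
      have hopt : optWealth l β b ξ = b / l := by rw [optWealth, if_neg h1.not_gt, if_pos h2]
      have hτ : 1 < ξ / l := (one_lt_div hl).2 h2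
      have hval : ξ * (b / l) / b = ξ / l := by field_simp
      rw [hopt, hval, if_pos h1, if_pos h1, max_eq_left (by linarith), hlogX]
      have hρ : 0 < c * l / b := by positivity
      have htr := floor_tradeoff hτ hρ
      have hprod : ξ / l * (c * l / b) = ξ * c / b := by field_simp
      have hlogc : Real.log c = Real.log (c * l / b) + Real.log (b / l) := by
        rw [← Real.log_mul hρ.ne' (by positivity)]
        congr 1
        field_simp
      have hlogl : Real.log (b / l) = Real.log (ξ / l) + Real.log (b / ξ) := by
        rw [← Real.log_mul (by positivity) (by positivity)]
        congr 1
        field_simp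
      rw [hprod] at htr
      rw [hlogc]
      have hcl : c * l / b = 1 → c = b / l := fun h => by
        rw [div_eq_one_iff_eq hb.ne'] at h
        rw [← h, mul_div_cancel_right₀ _ hl.ne']
      by_cases hA : c ≤ X
      · rw [if_pos hA]
        have h3 := (huA hA).1
        refine ⟨by linarith [htr.1], fun h => ⟨fun _ => hcl (htr.2 (by linarith [htr.1])),
          fun hc' hne => ?_⟩⟩
        have h4 := (huA hA).2 (by linarith [htr.1])
        rw [hξl hc', max_eq_left hτ.le] at h4
        rw [hXY, h4]
        field_simp
      · rw [if_neg hA]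
        have h3 := hmono h1
        refine ⟨by linarith [htr.1, hu0.1], fun h =>
          ⟨fun _ => hcl (htr.2 (by linarith [htr.1, hu0.1])), fun hc' hne => ?_⟩⟩
        have h4 := hstrict (lt_of_le_of_ne h1 hne) (hβl hc')
        linarith [htr.1, hu0.1]
    · -- cheap states
      have hopt : optWealth l β b ξ = b / ξ := by
        rw [optWealth, if_neg h1.not_gt, if_neg h2.not_gt]
      have hone : ξ * (b / ξ) / b = 1 := by field_simp
      have hm : max (ξ / l - 1) 0 = 0 := by
        rw [max_eq_right]
        have := (div_le_one hl).2 h2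
        linarith
      rw [hopt, hone, if_pos h1, if_pos h1, hm, hlogX]
      by_cases hA : c ≤ X
      · rw [if_pos hA]
        refine ⟨by linarith, fun h => ⟨fun hm => absurd hm.1 h2.not_gt, fun hcl _ => ?_⟩⟩
        rw [hXY, hu0.2 (by linarith), one_mul]
      · rw [if_neg hA]
        refine ⟨by linarith, fun h => ⟨fun hm => absurd hm.1 h2.not_gt, fun hcl _ => ?_⟩⟩
        have h4 := floorCost_lt (zero_lt_one.trans (hβl hcl)) (hβl hcl)
        rw [floorCost_of_le zero_le_one] at h4
        linarith

end Pointwise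

end MeanWVaR

namespace MeanWVaR

namespace Market

variable {Ω : Type*} [MeasurableSpace Ω] {P : Measure Ω} (M : Market P)

/-! ### The digital payoff minimises the Value-at-Risk -/

variable [IsProbabilityMeasure P]

lemma setIntegral_ξT_le_ξα (hθ : M.μ ≠ M.r) {α : ℝ} (hα : α ∈ Ioo (0 : ℝ) 1) :
    ∫ ω in {ω | M.ξT ω ≤ M.ξα α}, M.ξT ω ∂P = M.meanξ * (1 - M.w α) := by
  have h1 := M.w_one_sub_Fξ hθ (M.ξα α)
  rw [M.Fξ_ξα hθ hα, sub_sub_cancel] at h1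
  have h2 := integral_add_compl (M.measurableSet_ξT_le (M.ξα α)) M.integrable_ξT
  have h3 : {ω | M.ξT ω ≤ M.ξα α}ᶜ = {ω | M.ξα α < M.ξT ω} := by ext ω; simp
  rw [h3, ← h1] at h2
  have h4 : M.meanξ = ∫ ω, M.ξT ω ∂P := rfl
  rw [← h4] at h2
  linarith

/-- Neyman-Pearson: a wealth that is at least `c` with probability at least `P(ξ_T ≤ β)` costs at
least as much as the digital payoff `c` on `ξ_T ≤ β`, with equality only for that payoff. -/
lemma digital_cost_le (hθ : M.μ ≠ M.r) {β c : ℝ} (hβ : 0 < β) (hc : 0 < c) {Y : Ω → ℝ}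
    (hm : Measurable Y) (h0 : ∀ᵐ ω ∂P, 0 ≤ Y ω) (hi : Integrable (fun ω => M.ξT ω * Y ω) P)
    (hprob : M.Fξ β ≤ P.real {ω | c ≤ Y ω}) :
    c * ∫ ω in {ω | M.ξT ω ≤ β}, M.ξT ω ∂P ≤ ∫ ω, M.ξT ω * Y ω ∂P ∧
      (c * ∫ ω in {ω | M.ξT ω ≤ β}, M.ξT ω ∂P = ∫ ω, M.ξT ω * Y ω ∂P →
        Y =ᵐ[P] fun ω => if β < M.ξT ω then 0 else c) := by
  set A := {ω | c ≤ Y ω} with hA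
  set B := {ω | M.ξT ω ≤ β} with hB
  have hAm : MeasurableSet A := hm measurableSet_Ici
  have hBm : MeasurableSet B := M.measurableSet_ξT_le β
  -- `c β` is the multiplier of the probability constraint
  set D : Ω → ℝ := fun ω => (M.ξT ω * Y ω - c * B.indicator M.ξT ω) -
    c * β * (A.indicator 1 ω - B.indicator 1 ω) with hD
  have h1A : Integrable (A.indicator (1 : Ω → ℝ)) P := (integrable_const 1).indicator hAm
  have h1B : Integrable (B.indicator (1 : Ω → ℝ)) P := (integrable_const 1).indicator hBm
  have hξB : Integrable (B.indicator M.ξT) P := M.integrable_ξT.indicator hBm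
  have hsub : Integrable (fun ω => M.ξT ω * Y ω - c * B.indicator M.ξT ω) P :=
    hi.sub (hξB.const_mul c)
  have hpenalty : Integrable
      (fun ω => c * β * (A.indicator (1 : Ω → ℝ) ω - B.indicator 1 ω)) P :=
    (h1A.sub h1B).const_mul (c * β)
  have hDi : Integrable D P := hsub.sub hpenalty
  have hDint : ∫ ω, D ω ∂P = (∫ ω, M.ξT ω * Y ω ∂P - c * ∫ ω in B, M.ξT ω ∂P) -
      c * β * (P.real A - M.Fξ β) := by
    simp only [hD]
    rw [integral_sub hsub hpenalty, integral_sub hi (hξB.const_mul c), integral_const_mul, integral_const_mul,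
      integral_sub h1A h1B, integral_indicator hBm, integral_indicator_one hAm,
      integral_indicator_one hBm]
    rfl
  have hpt : ∀ᵐ ω ∂P, 0 ≤ D ω ∧
      (D ω = 0 → M.ξT ω ≠ β → Y ω = if β < M.ξT ω then 0 else c) := by
    filter_upwards [h0] with ω hω
    have hξ := M.ξT_pos ω
    have hξY := mul_nonneg hξ.le hω
    by_cases ha : c ≤ Y ω <;> by_cases hb : M.ξT ω ≤ β
    · have hval : D ω = M.ξT ω * (Y ω - c) := by
        simp only [hD, hA, hB, indicator, mem_ofPred_eq, ha, hb, if_true]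
        ring
      rw [hval, if_neg hb.not_gt]
      refine ⟨mul_nonneg hξ.le (by linarith), fun h _ => ?_⟩
      have := (mul_eq_zero.1 h).resolve_left hξ.ne'
      linarith
    · have hval : D ω = M.ξT ω * (Y ω - c) + c * (M.ξT ω - β) := by
        simp only [hD, hA, hB, indicator, mem_ofPred_eq, ha, hb, if_true, if_false, Pi.one_apply]
        ring
      have h1 : 0 < c * (M.ξT ω - β) := mul_pos hc (by linarith)
      have h2 : 0 ≤ M.ξT ω * (Y ω - c) := mul_nonneg hξ.le (by linarith)
      exact ⟨by linarith, fun h _ => by linarith⟩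
    · have hval : D ω = M.ξT ω * Y ω + c * (β - M.ξT ω) := by
        simp only [hD, hA, hB, indicator, mem_ofPred_eq, ha, hb, if_true, if_false, Pi.one_apply]
        ring
      refine ⟨?_, fun h hne => ?_⟩
      · have := mul_nonneg hc.le (sub_nonneg.2 hb)
        linarith
      · have := mul_pos hc (sub_pos.2 (lt_of_le_of_ne hb hne))
        linarith
    · have hval : D ω = M.ξT ω * Y ω := by
        simp only [hD, hA, hB, indicator, mem_ofPred_eq, ha, hb, if_false]
        ring
      rw [hval, if_pos (not_le.1 hb)]
      exact ⟨hξY, fun h _ => (mul_eq_zero.1 h).resolve_left hξ.ne'⟩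
  have hD0 : 0 ≤ᵐ[P] D := hpt.mono fun ω h => h.1
  have hge := integral_nonneg_of_ae hD0
  have hpen : 0 ≤ c * β * (P.real A - M.Fξ β) :=
    mul_nonneg (by positivity) (sub_nonneg.2 hprob)
  refine ⟨by linarith, fun heq => ?_⟩
  have hz : D =ᵐ[P] 0 := (integral_eq_zero_iff_of_nonneg_ae hD0 hDi).1 (by linarith)
  have hne : ∀ᵐ ω ∂P, M.ξT ω ≠ β := by
    rw [ae_iff]
    simpa using M.measure_ξT_eq hθ β
  filter_upwards [hpt, hz, hne] with ω h1 h2 h3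
  exact h1.2 h2 h3

section MinVaR

variable {α x : ℝ}

lemma minVaRLevel_pos (hθ : M.μ ≠ M.r) (hα : α ∈ Ioo (0 : ℝ) 1) (hx : 0 < x) :
    0 < M.minVaRLevel α x := by
  have h1 : 0 < 1 - M.w α := sub_pos.2 (M.w_mem_Ioo hθ hα).2
  have h2 := M.meanξ_pos
  rw [minVaRLevel]
  positivity

lemma minVaRLevel_mul (hθ : M.μ ≠ M.r) (hα : α ∈ Ioo (0 : ℝ) 1) :
    M.minVaRLevel α x * ∫ ω in {ω | M.ξT ω ≤ M.ξα α}, M.ξT ω ∂P = x := by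
  have h1 : 1 - M.w α ≠ 0 := (sub_pos.2 (M.w_mem_Ioo hθ hα).2).ne'
  have h2 := M.meanξ_pos.ne'
  rw [M.setIntegral_ξT_le_ξα hθ hα, minVaRLevel]
  field_simp

omit [IsProbabilityMeasure P] in
lemma measurable_minVaRWealth : Measurable (M.minVaRWealth α x) :=
  Measurable.ite (M.measurable_ξT measurableSet_Ioi) measurable_const measurable_const

lemma feasible_minVaRWealth (hθ : M.μ ≠ M.r) (hα : α ∈ Ioo (0 : ℝ) 1) (hx : 0 < x) :
    M.Feasible x (M.minVaRWealth α x) := by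
  have hL := M.minVaRLevel_pos hθ hα hx
  have heq : (fun ω => M.ξT ω * M.minVaRWealth α x ω) =
      fun ω => M.minVaRLevel α x * {ω | M.ξT ω ≤ M.ξα α}.indicator M.ξT ω := by
    ext ω
    simp only [minVaRWealth, indicator, mem_ofPred_eq]
    split_ifs with h1 h2
    · linarith
    · ring
    · ring
    · linarith
  refine M.feasible_of_integral_le M.measurable_minVaRWealth (fun ω => ?_) ?_ ?_
  · rw [minVaRWealth]
    split_ifs
    · exact le_rfl
    · exact hL.le
  · rw [heq]
    exact (M.integrable_ξT.indicator (M.measurableSet_ξT_le _)).const_mul _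
  · rw [heq, integral_const_mul, integral_indicator (M.measurableSet_ξT_le _),
      M.minVaRLevel_mul hθ hα]

lemma R_minVaRWealth (hθ : M.μ ≠ M.r) (hα : α ∈ Ioo (0 : ℝ) 1) (hx : 0 < x) (ω : Ω) :
    M.R x (M.minVaRWealth α x) ω = if M.ξα α < M.ξT ω then ⊥
      else ((1 / M.T * Real.log (M.minVaRLevel α x / x) : ℝ) : EReal) := by
  split_ifs with h
  · exact M.R_of_nonpos hx (by rw [minVaRWealth, if_pos h])
  · have h1 : M.minVaRWealth α x ω = M.minVaRLevel α x := by rw [minVaRWealth, if_neg h]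
    rw [M.R_of_pos hx (by rw [h1]; exact M.minVaRLevel_pos hθ hα hx), h1]

lemma quantile_minVaRWealth (hθ : M.μ ≠ M.r) (hα : α ∈ Ioo (0 : ℝ) 1) (hx : 0 < x) :
    quantile P (M.R x (M.minVaRWealth α x)) α =
      ((1 / M.T * Real.log (M.minVaRLevel α x / x) : ℝ) : EReal) := by
  have hL := M.minVaRLevel_pos hθ hα hx
  refine le_antisymm (quantile_le_coe P hα.2 ?_) ((coe_le_quantile_iff P hα.2 _ _).2 ?_)
  · simp only [M.R_le_iff hx _ _ hL]
    have : {ω | M.minVaRWealth α x ω ≤ M.minVaRLevel α x} = univ := by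
      ext ω
      simp only [minVaRWealth, mem_ofPred_eq, mem_univ, iff_true]
      split_ifs
      · exact hL.le
      · exact le_rfl
    rw [this, probReal_univ]
    exact hα.2
  · simp only [M.R_lt_iff hx _ _ hL]
    have h1 : {ω | M.minVaRWealth α x ω < M.minVaRLevel α x} ⊆ {ω | M.ξα α < M.ξT ω} := by
      intro ω hω
      by_contra h
      simp only [mem_ofPred_eq] at h hω
      rw [minVaRWealth, if_neg h] at hω
      exact lt_irrefl _ hω
    refine (measureReal_mono h1).trans ?_
    rw [M.measureReal_lt_ξT, M.Fξ_ξα hθ hα, sub_sub_cancel]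

/-- No admissible wealth has a larger quantile of the log-return at `α` than the digital payoff. -/
lemma quantile_R_le (hθ : M.μ ≠ M.r) (hα : α ∈ Ioo (0 : ℝ) 1) (hx : 0 < x) {Y : Ω → ℝ}
    (hY : M.Feasible x Y) :
    quantile P (M.R x Y) α ≤ ((1 / M.T * Real.log (M.minVaRLevel α x / x) : ℝ) : EReal) := by
  have hL := M.minVaRLevel_pos hθ hα hx
  by_contra! hlt
  obtain ⟨g, hg1, hg2⟩ := EReal.lt_iff_exists_real_btwn.1 hlt
  obtain ⟨c, hc, rfl⟩ := M.exists_logReturn_eq hx g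
  have hp := (coe_le_quantile_iff P hα.2 _ _).1 hg2.le
  simp only [M.R_lt_iff hx _ _ hc] at hp
  have hp2 := measureReal_le_not_lt hY.measurable hp
  have h := (M.digital_cost_le hθ (M.ξα_pos hθ hα) hc hY.measurable hY.nonneg hY.integrable
    (by rwa [M.Fξ_ξα hθ hα])).1
  have h2 := h.trans (hY.integral_le M hx)
  rw [← M.minVaRLevel_mul (x := x) hθ hα] at h2
  have hK : 0 < ∫ ω in {ω | M.ξT ω ≤ M.ξα α}, M.ξT ω ∂P := by
    rw [M.setIntegral_ξT_le_ξα hθ hα]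
    exact mul_pos M.meanξ_pos (sub_pos.2 (M.w_mem_Ioo hθ hα).2)
  have h3 : c ≤ M.minVaRLevel α x := le_of_mul_le_mul_right h2 hK
  rw [EReal.coe_lt_coe_iff, mul_lt_mul_iff_right₀ (one_div_pos.2 M.T_pos),
    Real.log_lt_log_iff (div_pos hL hx) (div_pos hc hx), div_lt_div_iff_of_pos_right hx] at hg1
  linarith

lemma isMinRisk_minVaRWealth (hθ : M.μ ≠ M.r) (hα : α ∈ Ioo (0 : ℝ) 1) (hx : 0 < x) :
    M.IsMinRisk (Measure.dirac α) x (M.minVaRWealth α x) := by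
  refine ⟨M.feasible_minVaRWealth hθ hα hx, fun Y hY => ?_⟩
  rw [wvar_dirac P (Ioo_subset_Icc_self hα), wvar_dirac P (Ioo_subset_Icc_self hα),
    EReal.neg_le_neg_iff, M.quantile_minVaRWealth hθ hα hx]
  exact M.quantile_R_le hθ hα hx hY

lemma IsMinRisk.ae_eq (hθ : M.μ ≠ M.r) (hα : α ∈ Ioo (0 : ℝ) 1) (hx : 0 < x) {X : Ω → ℝ}
    (hX : M.IsMinRisk (Measure.dirac α) x X) : X =ᵐ[P] M.minVaRWealth α x := by
  have hL := M.minVaRLevel_pos hθ hα hx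
  have h := hX.2 _ (M.feasible_minVaRWealth hθ hα hx)
  rw [wvar_dirac P (Ioo_subset_Icc_self hα), wvar_dirac P (Ioo_subset_Icc_self hα),
    EReal.neg_le_neg_iff, M.quantile_minVaRWealth hθ hα hx, coe_le_quantile_iff P hα.2] at h
  simp only [M.R_lt_iff hx _ _ hL] at h
  have hp2 := measureReal_le_not_lt hX.1.measurable h
  have h2 := M.digital_cost_le hθ (M.ξα_pos hθ hα) hL hX.1.measurable hX.1.nonneg
    hX.1.integrable (by rwa [M.Fξ_ξα hθ hα])
  rw [M.minVaRLevel_mul hθ hα] at h2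
  exact h2.2 (le_antisymm h2.1 (hX.1.integral_le M hx))

lemma expect_minVaRWealth (hθ : M.μ ≠ M.r) (hα : α ∈ Ioo (0 : ℝ) 1) (hx : 0 < x) :
    expect P (M.R x (M.minVaRWealth α x)) = ⊥ := by
  refine eIntegral_eq_bot (top_le_iff.1 ?_)
  have hm : MeasurableSet {ω | M.ξα α < M.ξT ω} := M.measurable_ξT measurableSet_Ioi
  have hpos : P {ω | M.ξα α < M.ξT ω} ≠ 0 := by
    intro h0
    have h1 := M.measureReal_lt_ξT (M.ξα α)
    rw [measureReal_def, h0, M.Fξ_ξα hθ hα, sub_sub_cancel, ENNReal.toReal_zero] at h1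
    exact hα.1.ne h1
  calc (⊤ : ENNReal) = ⊤ * P {ω | M.ξα α < M.ξT ω} := (ENNReal.top_mul hpos).symm
    _ = ∫⁻ ω, {ω | M.ξα α < M.ξT ω}.indicator (fun _ => ⊤) ω ∂P :=
      (lintegral_indicator_const hm _).symm
    _ ≤ _ := by
      refine lintegral_mono fun ω => ?_
      by_cases h : M.ξα α < M.ξT ω
      · rw [M.R_minVaRWealth hθ hα hx, if_pos h]
        simp
      · rw [indicator_of_notMem (s := {ω | M.ξα α < M.ξT ω}) h]
        exact zero_le

end MinVaR

/-! ### Integrating the Lagrangian -/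

section Efficient

variable {l β b : ℝ}

omit [IsProbabilityMeasure P] in
lemma midDensity_eq (hl : 0 < l) :
    (fun ω => midDensity l β (M.ξT ω)) =
      fun ω => 1 / l * {ω | M.ξT ω ≤ β}.indicator (fun ω => max (M.ξT ω - l) 0) ω := by
  ext ω
  simp only [midDensity, indicator, mem_ofPred_eq]
  split_ifs
  · rw [mul_max_of_nonneg _ _ (by positivity), mul_zero]
    congr 1
    field_simp
  · simp

lemma integrable_midDensity (hl : 0 < l) : Integrable (fun ω => midDensity l β (M.ξT ω)) P := by
  rw [M.midDensity_eq hl]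
  exact ((M.integrable_call l).indicator (M.measurableSet_ξT_le β)).const_mul _

omit [IsProbabilityMeasure P] in
lemma integral_midDensity (hl : 0 < l) :
    ∫ ω, midDensity l β (M.ξT ω) ∂P = M.truncCall β l / l := by
  rw [M.midDensity_eq hl, integral_const_mul, integral_indicator (M.measurableSet_ξT_le β),
    truncCall, one_div_mul_eq_div]

omit [IsProbabilityMeasure P] in
lemma measurable_optWealth : Measurable fun ω => optWealth l β b (M.ξT ω) :=
  Measurable.ite (M.measurable_ξT measurableSet_Ioi) (measurable_const.div M.measurable_ξT)
    (Measurable.ite (M.measurable_ξT measurableSet_Ioi) measurable_const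
      (measurable_const.div M.measurable_ξT))

lemma integrable_log_optWealth (hb : 0 < b) :
    Integrable (fun ω => Real.log (optWealth l β b (M.ξT ω))) P := by
  have hbound : Integrable (fun ω => |Real.log b - Real.log (M.ξT ω)| + |Real.log (b / l)|) P :=
    (((integrable_const _).sub M.integrable_log_ξT).abs).add (integrable_const _)
  refine hbound.mono' (M.measurable_optWealth.log).aestronglyMeasurable
    (Filter.Eventually.of_forall fun ω => ?_)
  have h1 := abs_nonneg (Real.log b - Real.log (M.ξT ω))
  have h2 := abs_nonneg (Real.log (b / l))
  rw [Real.norm_eq_abs, optWealth]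
  split_ifs
  · rw [Real.log_div hb.ne' (M.ξT_pos ω).ne']; linarith
  · linarith
  · rw [Real.log_div hb.ne' (M.ξT_pos ω).ne']; linarith

omit [IsProbabilityMeasure P] in
/-- The price of the optimal wealth is `b` per state, plus the density of the floor. -/
lemma ξT_mul_optWealth (hl : 0 < l) (ω : Ω) :
    M.ξT ω * optWealth l β b (M.ξT ω) = b * (1 + midDensity l β (M.ξT ω)) := by
  have hξ := M.ξT_pos ω
  have hξ' := hξ.ne'
  rw [optWealth, midDensity]
  rcases lt_or_ge β (M.ξT ω) with h1 | h1
  · rw [if_pos h1, if_neg h1.not_ge]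
    field_simp
    simp
  · rw [if_neg h1.not_gt, if_pos h1]
    rcases lt_or_ge l (M.ξT ω) with h2 | h2
    · have := (one_lt_div hl).2 h2
      rw [if_pos h2, max_eq_left (by linarith)]
      field_simp
      ring
    · have := (div_le_one hl).2 h2
      rw [if_neg h2.not_gt, max_eq_right (by linarith)]
      field_simp
      simp

lemma integrable_ξT_mul_optWealth (hl : 0 < l) :
    Integrable (fun ω => M.ξT ω * optWealth l β b (M.ξT ω)) P := by
  simp only [M.ξT_mul_optWealth hl]
  exact ((integrable_const 1).add (M.integrable_midDensity hl)).const_mul b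

lemma integral_ξT_mul_optWealth (hl : 0 < l) :
    ∫ ω, M.ξT ω * optWealth l β b (M.ξT ω) ∂P = b * (1 + M.truncCall β l / l) := by
  simp only [M.ξT_mul_optWealth hl]
  rw [integral_const_mul, integral_add (integrable_const 1) (M.integrable_midDensity hl),
    M.integral_midDensity hl]
  simp

lemma lagrangian_integral (hl : 0 < l) (e c : ℝ) {Y : Ω → ℝ} (hm : Measurable Y)
    (hlog : Integrable (fun ω => Real.log (Y ω)) P)
    (hi : Integrable (fun ω => M.ξT ω * Y ω) P) :
    Integrable (fun ω => lagrangian l β b e c (M.ξT ω) (Y ω)) P ∧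
    ∫ ω, lagrangian l β b e c (M.ξT ω) (Y ω) ∂P =
      ∫ ω, Real.log (Y ω) ∂P - (∫ ω, M.ξT ω * Y ω ∂P) / b +
        e * (P.real {ω | c ≤ Y ω} - M.Fξ β) + M.truncCall β l / l * Real.log c := by
  have hAm : MeasurableSet {ω | c ≤ Y ω} := hm measurableSet_Ici
  have hBm := M.measurableSet_ξT_le β
  have hA : Integrable ({ω | c ≤ Y ω}.indicator (1 : Ω → ℝ)) P :=
    (integrable_const 1).indicator hAm
  have hB : Integrable ({ω | M.ξT ω ≤ β}.indicator (1 : Ω → ℝ)) P :=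
    (integrable_const 1).indicator hBm
  have heq : (fun ω => lagrangian l β b e c (M.ξT ω) (Y ω)) = fun ω =>
      Real.log (Y ω) - M.ξT ω * Y ω / b +
      e * ({ω | c ≤ Y ω}.indicator 1 ω - {ω | M.ξT ω ≤ β}.indicator 1 ω) +
      midDensity l β (M.ξT ω) * Real.log c := by
    ext ω
    simp only [lagrangian, midDensity, indicator, mem_ofPred_eq, Pi.one_apply]
  have i1 : Integrable (fun ω => Real.log (Y ω) - M.ξT ω * Y ω / b) P :=
    hlog.sub (hi.div_const b)
  have i2 : Integrable (fun ω => e * ({ω | c ≤ Y ω}.indicator (1 : Ω → ℝ) ω -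
      {ω | M.ξT ω ≤ β}.indicator 1 ω)) P := (hA.sub hB).const_mul e
  have i12 : Integrable (fun ω => Real.log (Y ω) - M.ξT ω * Y ω / b +
      e * ({ω | c ≤ Y ω}.indicator (1 : Ω → ℝ) ω - {ω | M.ξT ω ≤ β}.indicator 1 ω)) P := i1.add i2
  have i3 := (M.integrable_midDensity (β := β) hl).mul_const (Real.log c)
  rw [heq]
  refine ⟨i12.add i3, ?_⟩
  rw [integral_add i12 i3, integral_add i1 i2, integral_sub hlog (hi.div_const b),
    integral_div, integral_const_mul, integral_sub hA hB, integral_mul_const,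
    M.integral_midDensity hl, integral_indicator_one hAm, integral_indicator_one hBm]
  rfl

/-- Duality: among the wealths within the budget of the optimal one that are at least `c` with
probability at least `P(ξ_T ≤ β)`, over all floors `c`, the expected logarithm plus the reward for
`log c` is largest for the optimal wealth with floor `b / l`, and only there. -/
lemma expected_log_add_le (hθ : M.μ ≠ M.r) (hl : 0 < l) (hlβ : l < β) (hb : 0 < b) {c : ℝ}
    (hc : 0 < c) {Y : Ω → ℝ} (hm : Measurable Y) (hpos : ∀ᵐ ω ∂P, 0 < Y ω)
    (hlog : Integrable (fun ω => Real.log (Y ω)) P)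
    (hi : Integrable (fun ω => M.ξT ω * Y ω) P)
    (hbud : ∫ ω, M.ξT ω * Y ω ∂P ≤ b * (1 + M.truncCall β l / l))
    (hprob : M.Fξ β ≤ P.real {ω | c ≤ Y ω}) :
    ∫ ω, Real.log (Y ω) ∂P + M.truncCall β l / l * Real.log c ≤
      ∫ ω, Real.log (optWealth l β b (M.ξT ω)) ∂P + M.truncCall β l / l * Real.log (b / l) ∧
    (∫ ω, Real.log (Y ω) ∂P + M.truncCall β l / l * Real.log c =
      ∫ ω, Real.log (optWealth l β b (M.ξT ω)) ∂P + M.truncCall β l / l * Real.log (b / l) →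
      Y =ᵐ[P] fun ω => optWealth l β b (M.ξT ω)) := by
  set e := floorCost (β * c / b) with he
  obtain ⟨iY, eY⟩ := M.lagrangian_integral (β := β) (b := b) hl e c hm hlog hi
  obtain ⟨iZ, eZ⟩ := M.lagrangian_integral (β := β) (b := b) hl e (b / l)
    (Y := fun ω => optWealth l β b (M.ξT ω)) M.measurable_optWealth
    (M.integrable_log_optWealth hb) (M.integrable_ξT_mul_optWealth hl)
  have hset : {ω | b / l ≤ optWealth l β b (M.ξT ω)} = {ω | M.ξT ω ≤ β} := by
    ext ω
    exact div_le_optWealth_iff hl hlβ hb (M.ξT_pos ω)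
  have hF : P.real {ω | M.ξT ω ≤ β} = M.Fξ β := rfl
  rw [hset, hF, M.integral_ξT_mul_optWealth hl, sub_self, mul_zero, add_zero] at eZ
  have hpt : ∀ᵐ ω ∂P, lagrangian l β b e c (M.ξT ω) (Y ω) ≤
      lagrangian l β b e (b / l) (M.ξT ω) (optWealth l β b (M.ξT ω)) ∧
      (lagrangian l β b e c (M.ξT ω) (Y ω) =
        lagrangian l β b e (b / l) (M.ξT ω) (optWealth l β b (M.ξT ω)) →
        (M.ξT ω ∈ Ioc l β → c = b / l) ∧
        (c = b / l → M.ξT ω ≠ β → Y ω = optWealth l β b (M.ξT ω))) := by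
    filter_upwards [hpos] with ω hω
    exact lagrangian_le hl hlβ hb hc (M.ξT_pos ω) hω
  have hmono := integral_mono_ae iY iZ (hpt.mono fun ω h => h.1)
  have hpen : 0 ≤ e * (P.real {ω | c ≤ Y ω} - M.Fξ β) :=
    mul_nonneg (floorCost_nonneg _) (sub_nonneg.2 hprob)
  have hbud' : (∫ ω, M.ξT ω * Y ω ∂P) / b ≤ b * (1 + M.truncCall β l / l) / b := by gcongr
  rw [eY, eZ] at hmono
  refine ⟨by linarith, fun heq => ?_⟩
  have hint : ∫ ω, lagrangian l β b e c (M.ξT ω) (Y ω) ∂P =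
      ∫ ω, lagrangian l β b e (b / l) (M.ξT ω) (optWealth l β b (M.ξT ω)) ∂P := by
    rw [eY, eZ]
    linarith
  have hae := (integral_eq_iff_of_ae_le iY iZ (hpt.mono fun ω h => h.1)).1 hint
  have hcl : c = b / l := by
    by_contra hne
    refine (M.measure_ξT_mem_Ioo_pos hθ hl.le hlβ).ne' ?_
    have hnull : ∀ᵐ ω ∂P, ¬ M.ξT ω ∈ Ioo l β := by
      filter_upwards [hpt, hae] with ω h1 h2 h3
      exact hne ((h1.2 h2).1 ⟨h3.1, h3.2.le⟩)
    rw [ae_iff] at hnull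
    simpa using hnull
  have hne : ∀ᵐ ω ∂P, M.ξT ω ≠ β := by
    rw [ae_iff]
    simpa using M.measure_ξT_eq hθ β
  filter_upwards [hpt, hae, hne] with ω h1 h2 h3
  exact (h1.2 h2).2 hcl h3

end Efficient

/-! ### The mean-VaR efficient wealth -/

section MeanVaR

variable {α lam x s : ℝ}

omit [IsProbabilityMeasure P] in
lemma effVaRWealth_eq :
    M.effVaRWealth α lam x s =
      fun ω => optWealth (M.ξLow s) (M.ξα α) (lam / (1 + lam) * x) (M.ξT ω) := by
  ext ω
  simp only [effVaRWealth, optWealth, effVaRLevel, mul_div_assoc]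

lemma effVaRWealth_pos (hθ : M.μ ≠ M.r) (hα : α ∈ Ioo (0 : ℝ) 1) (hl : 0 < lam) (hx : 0 < x)
    (hs : s ∈ Ioo (M.w α) 1) (ω : Ω) : 0 < M.effVaRWealth α lam x s ω := by
  rw [M.effVaRWealth_eq]
  exact optWealth_pos (M.ξLow_mem hθ hα hs).1 (by positivity) (M.ξT_pos ω)

lemma effVaRLevel_pos (hθ : M.μ ≠ M.r) (hα : α ∈ Ioo (0 : ℝ) 1) (hl : 0 < lam) (hx : 0 < x)
    (hs : s ∈ Ioo (M.w α) 1) : 0 < M.effVaRLevel lam x s := by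
  have := (M.ξLow_mem hθ hα hs).1
  rw [effVaRLevel]
  positivity

lemma IsTangency.truncCall_div (hθ : M.μ ≠ M.r) (hα : α ∈ Ioo (0 : ℝ) 1) (hl : 0 < lam)
    (hs : M.IsTangency (Measure.dirac α) α lam s) :
    M.truncCall (M.ξα α) (M.ξLow s) / M.ξLow s = 1 / lam := by
  obtain ⟨hs1, hs2⟩ := (M.isTangency_iff hθ hα hl).1 hs
  rw [div_eq_div_iff (M.ξLow_mem hθ hα hs1).1.ne' hl.ne', one_mul, mul_comm]
  exact hs2

/-- At the tangency point the candidate uses up the budget exactly. -/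
lemma IsTangency.budget (hθ : M.μ ≠ M.r) (hα : α ∈ Ioo (0 : ℝ) 1) (hl : 0 < lam)
    (hs : M.IsTangency (Measure.dirac α) α lam s) :
    lam / (1 + lam) * x * (1 + M.truncCall (M.ξα α) (M.ξLow s) / M.ξLow s) = x := by
  rw [hs.truncCall_div M hθ hα hl]
  field_simp
  ring

lemma feasible_effVaRWealth (hθ : M.μ ≠ M.r) (hα : α ∈ Ioo (0 : ℝ) 1) (hl : 0 < lam) (hx : 0 < x)
    (hs : M.IsTangency (Measure.dirac α) α lam s) : M.Feasible x (M.effVaRWealth α lam x s) := by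
  have hlow := (M.ξLow_mem hθ hα hs.1).1
  refine M.feasible_of_integral_le ?_ (fun ω => (M.effVaRWealth_pos hθ hα hl hx hs.1 ω).le) ?_ ?_
  · rw [M.effVaRWealth_eq]
    exact M.measurable_optWealth
  · rw [M.effVaRWealth_eq]
    exact M.integrable_ξT_mul_optWealth hlow
  · rw [M.effVaRWealth_eq, M.integral_ξT_mul_optWealth hlow, hs.budget M hθ hα hl]

lemma quantile_effVaRWealth (hθ : M.μ ≠ M.r) (hα : α ∈ Ioo (0 : ℝ) 1) (hl : 0 < lam) (hx : 0 < x)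
    (hs : s ∈ Ioo (M.w α) 1) :
    quantile P (M.R x (M.effVaRWealth α lam x s)) α =
      ((1 / M.T * Real.log (M.effVaRLevel lam x s / x) : ℝ) : EReal) := by
  have hlow := M.ξLow_mem hθ hα hs
  have hL := M.effVaRLevel_pos hθ hα hl hx hs
  have hLeq : M.effVaRLevel lam x s = lam / (1 + lam) * x / M.ξLow s := by
    rw [effVaRLevel, mul_div_assoc]
  have hb : 0 < lam / (1 + lam) * x := by positivity
  refine le_antisymm (quantile_le_coe P hα.2 ?_) ((coe_le_quantile_iff P hα.2 _ _).2 ?_)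
  · simp only [M.R_le_iff hx _ _ hL]
    have h1 : {ω | M.ξLow s < M.ξT ω} ⊆
        {ω | M.effVaRWealth α lam x s ω ≤ M.effVaRLevel lam x s} := by
      intro ω hω
      have hω' : M.ξLow s < M.ξT ω := hω
      have h2 : lam / (1 + lam) * x / M.ξT ω ≤ lam / (1 + lam) * x / M.ξLow s :=
        div_le_div_of_nonneg_left hb.le hlow.1 hω'.le
      simp only [mem_ofPred_eq, M.effVaRWealth_eq, hLeq, optWealth]
      split_ifs
      · exact h2
      · exact le_rfl
    refine lt_of_lt_of_le ?_ (measureReal_mono h1)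
    have h3 := M.Fξ_lt hθ hlow.1.le hlow.2
    rw [M.Fξ_ξα hθ hα] at h3
    rw [M.measureReal_lt_ξT]
    linarith
  · simp only [M.R_lt_iff hx _ _ hL]
    have h1 : {ω | M.effVaRWealth α lam x s ω < M.effVaRLevel lam x s} ⊆
        {ω | M.ξα α < M.ξT ω} := by
      intro ω hω
      by_contra h
      simp only [mem_ofPred_eq, M.effVaRWealth_eq, hLeq] at h hω
      exact hω.not_ge
        ((div_le_optWealth_iff hlow.1 hlow.2 hb (M.ξT_pos ω)).2 (not_lt.1 h))
    refine (measureReal_mono h1).trans ?_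
    rw [M.measureReal_lt_ξT, M.Fξ_ξα hθ hα, sub_sub_cancel]

lemma objective_effVaRWealth (hθ : M.μ ≠ M.r) (hα : α ∈ Ioo (0 : ℝ) 1) (hl : 0 < lam)
    (hx : 0 < x) (hs : s ∈ Ioo (M.w α) 1) :
    M.objective (Measure.dirac α) lam x (M.effVaRWealth α lam x s) =
      ((lam * (1 / M.T * (∫ ω, Real.log (M.effVaRWealth α lam x s ω) ∂P - Real.log x)) +
        1 / M.T * Real.log (M.effVaRLevel lam x s / x) : ℝ) : EReal) := by
  have hb : 0 < lam / (1 + lam) * x := by positivity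
  rw [M.objective_dirac (Ioo_subset_Icc_self hα), M.quantile_effVaRWealth hθ hα hl hx hs,
    M.expect_R_of_integrable hx
      (Filter.Eventually.of_forall (M.effVaRWealth_pos hθ hα hl hx hs))
      (by rw [M.effVaRWealth_eq]; exact M.integrable_log_optWealth hb),
    EReal.coe_add, EReal.coe_mul lam]

/-- The candidate has the largest objective among the admissible wealths, and a.s. no other one
attains it. -/
lemma objective_le (hθ : M.μ ≠ M.r) (hα : α ∈ Ioo (0 : ℝ) 1) (hl : 0 < lam) (hx : 0 < x)
    (hs : M.IsTangency (Measure.dirac α) α lam s) {Y : Ω → ℝ} (hY : M.Feasible x Y) :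
    M.objective (Measure.dirac α) lam x Y ≤
        M.objective (Measure.dirac α) lam x (M.effVaRWealth α lam x s) ∧
      (M.objective (Measure.dirac α) lam x Y =
        M.objective (Measure.dirac α) lam x (M.effVaRWealth α lam x s) →
        Y =ᵐ[P] M.effVaRWealth α lam x s) := by
  rw [M.objective_effVaRWealth hθ hα hl hx hs.1, M.objective_dirac (Ioo_subset_Icc_self hα)]
  by_cases hE : expect P (M.R x Y) = ⊥
  · rw [hE, EReal.coe_mul_bot_of_pos hl, EReal.bot_add]
    exact ⟨bot_le, fun h => absurd h (EReal.bot_lt_coe _).ne⟩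
  obtain ⟨hpos, hlog⟩ := hY.integrable_log M hx hE
  rw [M.expect_R_of_integrable hx hpos hlog, ← EReal.coe_mul]
  set V := lam * (1 / M.T * (∫ ω, Real.log (M.effVaRWealth α lam x s ω) ∂P - Real.log x)) +
        1 / M.T * Real.log (M.effVaRLevel lam x s / x) with hV
  set u := lam * (1 / M.T * (∫ ω, Real.log (Y ω) ∂P - Real.log x)) with hu
  have key : ∀ g : ℝ, (g : EReal) ≤ quantile P (M.R x Y) α →
      u + g ≤ V ∧ (u + g = V → Y =ᵐ[P] M.effVaRWealth α lam x s) := by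
    intro g hg
    obtain ⟨c, hc, rfl⟩ := M.exists_logReturn_eq hx g
    rw [coe_le_quantile_iff P hα.2] at hg
    simp only [M.R_lt_iff hx _ _ hc] at hg
    have hp2 := measureReal_le_not_lt hY.measurable hg
    have hlow := M.ξLow_mem hθ hα hs.1
    have hb : 0 < lam / (1 + lam) * x := by positivity
    have h := M.expected_log_add_le hθ hlow.1 hlow.2 hb hc hY.measurable hpos hlog hY.integrable
      (by rw [hs.budget M hθ hα hl]; exact hY.integral_le M hx) (by rwa [M.Fξ_ξα hθ hα])
    have hLeq : lam / (1 + lam) * x / M.ξLow s = M.effVaRLevel lam x s := by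
      rw [effVaRLevel, mul_div_assoc]
    have hL := M.effVaRLevel_pos hθ hα hl hx hs.1
    have hW : ∀ ω, optWealth (M.ξLow s) (M.ξα α) (lam / (1 + lam) * x) (M.ξT ω) =
        M.effVaRWealth α lam x s ω := fun ω => (congrFun M.effVaRWealth_eq ω).symm
    simp only [hW, hs.truncCall_div M hθ hα hl, hLeq] at h
    have hfac : 0 < lam / M.T := div_pos hl M.T_pos
    have hdiff : V - (u + 1 / M.T * Real.log (c / x)) = lam / M.T *
        ((∫ ω, Real.log (M.effVaRWealth α lam x s ω) ∂P +
          1 / lam * Real.log (M.effVaRLevel lam x s)) -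
        (∫ ω, Real.log (Y ω) ∂P + 1 / lam * Real.log c)) := by
      have hT := M.T_pos.ne'
      rw [hV, hu, Real.log_div hc.ne' hx.ne', Real.log_div hL.ne' hx.ne']
      field_simp
      ring
    refine ⟨?_, fun heq => h.2 ?_⟩
    · have := mul_nonneg hfac.le (sub_nonneg.2 h.1)
      linarith
    · rw [heq, sub_self, eq_comm, mul_eq_zero] at hdiff
      have := hdiff.resolve_left hfac.ne'
      linarith
  generalize quantile P (M.R x Y) α = q at key ⊢
  induction q with
  | bot =>
    rw [EReal.add_bot]
    exact ⟨bot_le, fun h => absurd h (EReal.bot_lt_coe _).ne⟩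
  | top =>
    have := (key (V - u + 1) le_top).1
    linarith
  | coe g =>
    rw [← EReal.coe_add, EReal.coe_le_coe_iff, EReal.coe_eq_coe_iff]
    exact key g le_rfl

end MeanVaR

end Market

end MeanWVaR

open MeasureTheory MeanWVaR in
theorem proposition4p1 {Ω : Type*} [MeasurableSpace Ω] (P : Measure Ω) [IsProbabilityMeasure P]
    (M : Market P) (hθ : M.μ ≠ M.r) (x : ℝ) (hx : 0 < x) (α : ℝ) (hα0 : 0 < α) (hα1 : α < 1) :
    -- the case `λ = 0`
    (M.IsMinRisk (Measure.dirac α) x (M.minVaRWealth α x) ∧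
      (∀ X, M.IsMinRisk (Measure.dirac α) x X → X =ᵐ[P] M.minVaRWealth α x) ∧
      (∀ ω, M.R x (M.minVaRWealth α x) ω =
        if M.ξα α < M.ξT ω then ⊥
        else ((1 / M.T * Real.log (M.minVaRLevel α x / x) : ℝ) : EReal)) ∧
      expect P (M.R x (M.minVaRWealth α x)) = ⊥ ∧
      valueAtRisk P α (M.R x (M.minVaRWealth α x)) =
        ((-(1 / M.T * Real.log (M.minVaRLevel α x / x)) : ℝ) : EReal)) ∧
    -- the case `0 < λ < ∞`
    (∀ lam : ℝ, 0 < lam →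
      ∃ s : ℝ, M.IsTangency (Measure.dirac α) α lam s ∧
        (∀ s', M.IsTangency (Measure.dirac α) α lam s' → s' = s) ∧
        M.IsEfficient (Measure.dirac α) lam x (M.effVaRWealth α lam x s) ∧
        (∀ X, M.IsEfficient (Measure.dirac α) lam x X → X =ᵐ[P] M.effVaRWealth α lam x s) ∧
        (∀ ω, M.R x (M.effVaRWealth α lam x s) ω =
          ((1 / M.T * Real.log (M.effVaRWealth α lam x s ω / x) : ℝ) : EReal)) ∧
        valueAtRisk P α (M.R x (M.effVaRWealth α lam x s)) =
          ((-(1 / M.T * Real.log (M.effVaRLevel lam x s / x)) : ℝ) : EReal)) := by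
  have hα : α ∈ Set.Ioo (0 : ℝ) 1 := ⟨hα0, hα1⟩
  refine ⟨⟨M.isMinRisk_minVaRWealth hθ hα hx, fun X hX => hX.ae_eq M hθ hα hx,
    M.R_minVaRWealth hθ hα hx, M.expect_minVaRWealth hθ hα hx, ?_⟩, fun lam hl => ?_⟩
  · rw [valueAtRisk, M.quantile_minVaRWealth hθ hα hx, EReal.coe_neg]
  · obtain ⟨s, hs, huniq⟩ := M.existsUnique_isTangency hθ hα hl
    have hfeas := M.feasible_effVaRWealth hθ hα hl hx hs
    refine ⟨s, hs, huniq, ⟨hfeas, fun Y hY => (M.objective_le hθ hα hl hx hs hY).1⟩,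
      fun X hX => ?_, fun ω => M.R_of_pos hx (M.effVaRWealth_pos hθ hα hl hx hs.1 ω), ?_⟩
    · have h := M.objective_le hθ hα hl hx hs hX.1
      exact h.2 (le_antisymm h.1 (hX.2 _ hfeas))
    · rw [valueAtRisk, M.quantile_effVaRWealth hθ hα hl hx hs.1, EReal.coe_neg]
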